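/- Let $\mathbb T=\mathbb R/2\pi\mathbb Z$, write $\int_{\mathbb T}f\,dx=\frac1{2\pi}\int_{-\pi}^{\pi}f(x)\,dx$, and for $s\ge 0$ let $H^s(\mathbb T)$ be the space of complex-valued $f\in L^2(\mathbb T)$ with $\|f\|_{H^s}^2=\sum_{k\in\mathbb Z}(1+k^2)^s|\hat f(k)|^2<\infty$, where $\hat f(k)=\int_{\mathbb T}f(x)e^{-ikx}\,dx$. Let $F(\alpha,\beta,\overline\alpha,\overline\beta)$ be a polynomial with complex coefficients in $\alpha,\beta,\overline\alpha,\overline\beta$, where $\alpha,\beta\in\mathbb C$, and let $F_\beta=\frac12\left(\frac{\partial F}{\partial a}-i\frac{\partial F}{\partial b}\right)$ for $\beta=a+ib$, $a,b\in\mathbb R$. Consider the Cauchy problem $$\partial_tu+i\partial_x^2u=F(u,\partial_xu,\overline u,\overline{\partial_xu}),\qquad u|_{t=0}=\phi. \tag{1}$$ For $s>\frac32$, $T>0$ and $\phi\in H^s(\mathbb T)$, a solution of (1) in $H^s(\mathbb T)$ on $[0,T]$ is a function $u\in L^\infty([0,T];H^s(\mathbb T))$ such that $$-\int_0^T\!\!\int_{\mathbb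 T}u\,\partial_t\chi\,dx\,dt-\int_{\mathbb T}\phi(x)\chi(0,x)\,dx+i\int_0^T\!\!\int_{\mathbb T}u\,\partial_x^2\chi\,dx\,dt=\int_0^T\!\!\int_{\mathbb T}F(u,\partial_xu,\overline u,\overline{\partial_xu})\,\chi\,dx\,dt$$ for every smooth function $\chi$ with compact support in $[0,T)\times\mathbb T$. A solution on $[-T,0]$ is a function $u\in L^\infty([-T,0];H^s(\mathbb T))$ such that $$-\int_{-T}^0\!\int_{\mathbb T}u\,\partial_t\chi\,dx\,dt+\int_{\mathbb T}\phi(x)\chi(0,x)\,dx+i\int_{-T}^0\!\int_{\mathbb T}u\,\partial_x^2\chi\,dx\,dt=\int_{-T}^0\!\int_{\mathbb T}F(u,\partial_xu,\overline u,\overline{\partial_xu})\,\chi\,dx\,dt$$ for every smooth function $\chi$ with compact support in $(-T,0]\times\mathbb T$. **Theorem.** Let $s>\frac52$. Suppose that there exists $\psi\in H^s(\mathbb T)$ such that $$\int_{\mathbb T}\operatorname{Im}F_\beta(\psi,\partial_x\psi,\overline\psi,\overline{\partial_x\psi})\,dx\neq0.$$ Then there exists $\phi\in H^s(\mathbb T)$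 such that, for every $T>0$, the problem (1) has no solution $u\in C([0,T];H^s(\mathbb T))$ on $[0,T]$ and no solution $u\in C([-T,0];H^s(\mathbb T))$ on $[-T,0]$. -/

import Mathlib

open MeasureTheory Set Complex
open scoped ComplexConjugate ContDiff ENNReal

noncomputable section

namespace PeriodicNLS

/-- The torus `ℝ / 2πℤ`. -/
abbrev Torus : Type := AddCircle (2 * Real.pi)

instance factTwoPiPos : Fact (0 < 2 * Real.pi) := ⟨Real.two_pi_pos⟩

/-- Complex `L²` functions on the torus, for the normalized measure `dx / 2π`. -/
abbrev L2Torus : Type := Lp ℂ 2 (AddCircle.haarAddCircle (T := 2 * Real.pi))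

/-- The Japanese bracket `⟨k⟩ = √(1 + k²)`. -/
def bracket (k : ℤ) : ℝ := Real.sqrt (1 + (k : ℝ) ^ 2)

/-- The Fourier coefficients `⟨k⟩ ^ s f̂(k)` of `⟨∂ₓ⟩ ^ s f`; here
`f̂(k) = (2π)⁻¹ ∫ f(x) e^{-ikx} dx`. -/
def weightedCoeff (s : ℝ) (f : L2Torus) (k : ℤ) : ℂ :=
  ((bracket k ^ s : ℝ) : ℂ) * fourierCoeff (f : Torus → ℂ) k

theorem fourierCoeff_eq_repr (f : L2Torus) (k : ℤ) :
    fourierCoeff (f : Torus → ℂ) k = fourierBasis.repr f k :=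
  (fourierBasis_repr f k).symm

theorem weightedCoeff_zero (s : ℝ) : weightedCoeff s 0 = 0 := by
  funext k
  simp only [weightedCoeff, fourierCoeff_eq_repr, map_zero]
  simp

theorem weightedCoeff_add (s : ℝ) (f g : L2Torus) :
    weightedCoeff s (f + g) = weightedCoeff s f + weightedCoeff s g := by
  funext k
  simp only [weightedCoeff, fourierCoeff_eq_repr, map_add, Pi.add_apply, lp.coeFn_add]
  ring

theorem weightedCoeff_smul (s : ℝ) (c : ℂ) (f : L2Torus) :
    weightedCoeff s (c • f) = c • weightedCoeff s f := by
  funext k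
  simp only [weightedCoeff, fourierCoeff_eq_repr, map_smul, Pi.smul_apply, lp.coeFn_smul,
    smul_eq_mul]
  ring

/-- The underlying vector space of `H^s` of the torus, `s ≥ 0`: the `L²` functions `f` with
`∑ ⟨k⟩ ^ (2 s) |f̂(k)|² < ∞`. -/
def sobolevSubmodule (s : ℝ) : Submodule ℂ L2Torus where
  carrier := {f | Memℓp (weightedCoeff s f) 2}
  zero_mem' := by
    simp only [mem_ofPred_eq, weightedCoeff_zero]
    exact zero_memℓp
  add_mem' := by
    intro f g hf hg
    simp only [mem_ofPred_eq, weightedCoeff_add] at *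
    exact hf.add hg
  smul_mem' := by
    intro c f hf
    simp only [mem_ofPred_eq, weightedCoeff_smul] at *
    exact hf.const_smul c

/-- The Sobolev space `H^s` of the torus, `s ≥ 0`. It is a type of its own, since its norm (below)
is the `H^s` norm and not the `L²` norm. -/
def Sobolev (s : ℝ) : Type := sobolevSubmodule s

namespace Sobolev

variable {s : ℝ}

instance : AddCommGroup (Sobolev s) := inferInstanceAs (AddCommGroup (sobolevSubmodule s))

instance : Module ℂ (Sobolev s) := inferInstanceAs (Module ℂ (sobolevSubmodule s))

/-- The inclusion of `H^s` in `L²`. -/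
def toL2 : Sobolev s →ₗ[ℂ] L2Torus := (sobolevSubmodule s).subtype

theorem toL2_injective : Function.Injective (toL2 : Sobolev s → L2Torus) :=
  Subtype.val_injective

theorem memℓp_weightedCoeff (f : Sobolev s) : Memℓp (weightedCoeff s (toL2 f)) 2 := f.2

/-- The map `f ↦ (⟨k⟩ ^ s f̂(k))ₖ` from `H^s` to `ℓ²`. -/
def toSeq : Sobolev s →ₗ[ℂ] lp (fun _ : ℤ => ℂ) 2 where
  toFun f := ⟨weightedCoeff s (toL2 f), memℓp_weightedCoeff f⟩
  map_add' f g := by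
    apply Subtype.ext
    simp only [map_add, weightedCoeff_add]
    rfl
  map_smul' c f := by
    apply Subtype.ext
    simp only [map_smul, weightedCoeff_smul]
    rfl

theorem bracket_pos (k : ℤ) : 0 < bracket k := Real.sqrt_pos.2 (by positivity)

theorem toSeq_injective : Function.Injective (toSeq : Sobolev s → lp (fun _ : ℤ => ℂ) 2) := by
  intro f g h
  apply toL2_injective
  apply fourierBasis.repr.injective
  apply lp.ext
  funext k
  have hk : weightedCoeff s (toL2 f) k = weightedCoeff s (toL2 g) k :=
    congrFun (congrArg Subtype.val h) k
  simp only [weightedCoeff, fourierCoeff_eq_repr] at hk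
  refine mul_left_cancel₀ ?_ hk
  exact_mod_cast (Real.rpow_pos_of_pos (bracket_pos k) s).ne'

/-- The norm of `H^s`, `‖f‖ = (∑ ⟨k⟩ ^ (2 s) |f̂(k)|²) ^ (1/2)`. -/
instance : NormedAddCommGroup (Sobolev s) :=
  NormedAddCommGroup.induced (Sobolev s) (lp (fun _ : ℤ => ℂ) 2) toSeq toSeq_injective

instance : NormedSpace ℂ (Sobolev s) := NormedSpace.induced ℂ (Sobolev s) _ toSeq

end Sobolev

open Classical in
/-- The derivative `∂ₓ f` of an `L²` function on the torus, in the sense of distributions: the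
`L²` function with Fourier coefficients `i k f̂(k)`. It is set to `0` if there is no such `L²`
function, which does not happen for `f` in `H^s` with `s ≥ 1`. -/
def L2Torus.dx (f : L2Torus) : L2Torus :=
  if h : Memℓp (fun k : ℤ => I * (k : ℂ) * fourierCoeff (f : Torus → ℂ) k) 2 then
    fourierBasis.repr.symm ⟨_, h⟩
  else 0

theorem Sobolev.fourierCoeff_dx {s : ℝ} (hs : 1 ≤ s) (f : Sobolev s) (k : ℤ) :
    fourierCoeff (L2Torus.dx (Sobolev.toL2 f) : Torus → ℂ) k
      = I * (k : ℂ) * fourierCoeff (Sobolev.toL2 f : Torus → ℂ) k := by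
  have h : Memℓp (fun k : ℤ => I * (k : ℂ) * fourierCoeff (Sobolev.toL2 f : Torus → ℂ) k) 2 := by
    refine (Sobolev.memℓp_weightedCoeff f).mono' fun k => ?_
    have h1 : 1 ≤ bracket k := Real.one_le_sqrt.2 (by nlinarith [sq_nonneg (k : ℝ)])
    have h2 : |(k : ℝ)| ≤ bracket k := Real.abs_le_sqrt (by linarith)
    have h3 : |(k : ℝ)| ≤ bracket k ^ s :=
      h2.trans (by simpa using Real.rpow_le_rpow_of_exponent_le h1 hs)
    rw [weightedCoeff, norm_mul, norm_mul, norm_mul, Complex.norm_real, norm_I, one_mul,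
      Complex.norm_intCast, Real.norm_of_nonneg (Real.rpow_nonneg (Sobolev.bracket_pos k).le s)]
    exact mul_le_mul_of_nonneg_right h3 (norm_nonneg _)
  rw [fourierCoeff_eq_repr, L2Torus.dx, dif_pos h, LinearIsometryEquiv.apply_symm_apply]

/-- The values `f(x)` of `f` in `H^s`, as a `2π`-periodic function of the real variable `x`
(defined up to null sets). -/
def Sobolev.val {s : ℝ} (f : Sobolev s) (x : ℝ) : ℂ := Sobolev.toL2 f (x : Torus)

/-- The values `∂ₓ f(x)` for `f` in `H^s`, as a `2π`-periodic function of the real variable `x`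
(defined up to null sets). -/
def Sobolev.dxVal {s : ℝ} (f : Sobolev s) (x : ℝ) : ℂ := L2Torus.dx (Sobolev.toL2 f) (x : Torus)

/-- The normalized integral `(2π)⁻¹ ∫_{-π}^{π} f(x) dx` over the torus. -/
def integralTorus {E : Type*} [NormedAddCommGroup E] [NormedSpace ℝ E] (f : ℝ → E) : E :=
  (2 * Real.pi)⁻¹ • ∫ x in (-Real.pi)..Real.pi, f x

/-- The value `F(α, β, conj α, conj β)` of a polynomial `F` in four variables. -/
def evalPoly (F : MvPolynomial (Fin 4) ℂ) (α β : ℂ) : ℂ :=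
  MvPolynomial.eval ![α, β, conj α, conj β] F

/-- The derivative `F_β = (1/2) (∂F/∂a - i ∂F/∂b)`, `β = a + i b`, of the function
`F(α, β, conj α, conj β)`. -/
def evalPolyBeta (F : MvPolynomial (Fin 4) ℂ) (α β : ℂ) : ℂ :=
  (1 / 2) * (deriv (fun a : ℝ => evalPoly F α (β + (a : ℂ))) 0
    - I * deriv (fun b : ℝ => evalPoly F α (β + (b : ℂ) * I)) 0)

/-- The nonlinearity `F(f, ∂ₓ f, conj f, conj (∂ₓ f))` as a function of `x`. -/
def nonlin {s : ℝ} (F : MvPolynomial (Fin 4) ℂ) (f : Sobolev s) (x : ℝ) : ℂ :=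
  evalPoly F (f.val x) (f.dxVal x)

/-- The function `F_β(f, ∂ₓ f, conj f, conj (∂ₓ f))` of `x`. -/
def nonlinBeta {s : ℝ} (F : MvPolynomial (Fin 4) ℂ) (f : Sobolev s) (x : ℝ) : ℂ :=
  evalPolyBeta F (f.val x) (f.dxVal x)

/-- Smooth functions `χ(t, x)` on `ℝ × Torus`, as functions that are `2π`-periodic in `x`. -/
structure IsSmoothPeriodic (χ : ℝ → ℝ → ℂ) : Prop where
  smooth : ContDiff ℝ ∞ (fun p : ℝ × ℝ => χ p.1 p.2)
  periodic : ∀ t, Function.Periodic (χ t) (2 * Real.pi)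

/-- (Extensions to `ℝ × Torus` of) smooth functions with compact support in `[0, T) × Torus`. -/
def IsTestForward (T : ℝ) (χ : ℝ → ℝ → ℂ) : Prop :=
  IsSmoothPeriodic χ ∧ ∃ T' < T, ∀ t, T' ≤ t → ∀ x, χ t x = 0

/-- (Extensions to `ℝ × Torus` of) smooth functions with compact support in `(-T, 0] × Torus`. -/
def IsTestBackward (T : ℝ) (χ : ℝ → ℝ → ℂ) : Prop :=
  IsSmoothPeriodic χ ∧ ∃ T' < T, ∀ t, t ≤ -T' → ∀ x, χ t x = 0

/-- `u` is a solution in `H^s` on `[0, T]` of `∂ₜ u + i ∂ₓ² u = F(u, ∂ₓ u, conj u, conj (∂ₓ u))`,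
`u(0) = φ`: it lies in `L^∞([0, T]; H^s)` and satisfies the equation, with the initial condition,
in the sense of distributions. -/
structure IsSolutionForward (F : MvPolynomial (Fin 4) ℂ) (s T : ℝ) (φ : Sobolev s)
    (u : ℝ → Sobolev s) : Prop where
  memLinfty : MemLp u ∞ (volume.restrict (Icc 0 T))
  weak : ∀ χ : ℝ → ℝ → ℂ, IsTestForward T χ →
    - (∫ t in (0 : ℝ)..T, integralTorus fun x => (u t).val x * deriv (fun τ => χ τ x) t)
      - integralTorus (fun x => φ.val x * χ 0 x)
      + I * (∫ t in (0 : ℝ)..T, integralTorus fun x => (u t).val x * iteratedDeriv 2 (χ t) x)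
    = ∫ t in (0 : ℝ)..T, integralTorus fun x => nonlin F (u t) x * χ t x

/-- `u` is a solution in `H^s` on `[-T, 0]` of `∂ₜ u + i ∂ₓ² u = F(u, ∂ₓ u, conj u, conj (∂ₓ u))`,
`u(0) = φ`. The boundary term has the opposite sign, as `t = 0` is now the right end point. -/
structure IsSolutionBackward (F : MvPolynomial (Fin 4) ℂ) (s T : ℝ) (φ : Sobolev s)
    (u : ℝ → Sobolev s) : Prop where
  memLinfty : MemLp u ∞ (volume.restrict (Icc (-T) 0))
  weak : ∀ χ : ℝ → ℝ → ℂ, IsTestBackward T χ →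
    - (∫ t in (-T)..(0 : ℝ), integralTorus fun x => (u t).val x * deriv (fun τ => χ τ x) t)
      + integralTorus (fun x => φ.val x * χ 0 x)
      + I * (∫ t in (-T)..(0 : ℝ), integralTorus fun x => (u t).val x * iteratedDeriv 2 (χ t) x)
    = ∫ t in (-T)..(0 : ℝ), integralTorus fun x => nonlin F (u t) x * χ t x

end PeriodicNLS

end

/-! Write v = ∂ₓu. Differentiating the equation gives v_t = -i v_xx + F_β v_x + F_β̄ conj(v_x) +
terms without derivatives of v. If F_β were a constant m and the conjugate term were absent, the
mode e^{inx} would grow at the rate Re(in² + inm) = -n Im m. When Im m ≠ 0 one sign of n grows like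
e^{|n||Im m|t} forward in time and the other sign backward. A bounded solution therefore forces its
datum to be nearly void at the growing frequencies, and a generic datum in H^s is not.

Three devices reduce the problem to this model. The coefficient is frozen at a trigonometric
polynomial φ₀ near the datum, and a gauge g with g' = (i/2)(a - m)g, a = F_β(φ₀), replaces a by its
mean m (`exists_gauge_estimate`). The conjugate term is nonresonant: W = ∫ conj(v) b g e^{-inx}, b =
F_β̄(φ₀), rotates like e^{-in²t} against e^{in²t}, so adding W/(2n) removes it to leading order
(`exists_conj_estimate`). The freezing error is small for short times, because a bounded solution
moves at a Hölder rate in a weaker norm (`exists_coef_sub_le`).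

Reading the growing mode backward in time bounds the datum at frequency n
(`exists_high_frequency_bound`). With t₁ = ⟨n⟩^{γ/4-1} the growth factor exp(c⟨n⟩^{γ/4}) is huge
while all errors stay small. Adding to φ₀ one mode of H^s size ⟨n⟩^{-γ/4} violates the bound, and so
does every datum in a small ball around the sum (`exists_ball_no_evolution`). Trigonometric
polynomials are dense, so Baire's theorem gives a single datum that works for both time directions,
all bounds and all times (`exists_forall_no_evolution`). -/

noncomputable section

namespace PeriodicNLS

/-! ### Japanese brackets, trigonometric series and coefficient decay -/

section

theorem one_le_bracket (k : ℤ) : 1 ≤ bracket k :=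
  Real.one_le_sqrt.2 (by nlinarith [sq_nonneg (k : ℝ)])

theorem bracket_pos (k : ℤ) : 0 < bracket k := Sobolev.bracket_pos k

theorem abs_le_bracket (k : ℤ) : |(k : ℝ)| ≤ bracket k := Real.abs_le_sqrt (by linarith)

theorem bracket_le_one_add_abs (k : ℤ) : bracket k ≤ 1 + |(k : ℝ)| := by
  refine Real.sqrt_le_iff.2 ⟨by positivity, ?_⟩
  nlinarith [abs_nonneg (k : ℝ), sq_abs (k : ℝ)]

theorem bracket_neg (k : ℤ) : bracket (-k) = bracket k := by simp [bracket]

theorem bracket_add_le (k l : ℤ) : bracket (k + l) ≤ bracket k + bracket l := by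
  have hk := Real.sq_sqrt (show 0 ≤ 1 + (k : ℝ) ^ 2 by positivity)
  have hl := Real.sq_sqrt (show 0 ≤ 1 + (l : ℝ) ^ 2 by positivity)
  refine Real.sqrt_le_iff.2 ⟨(add_pos (bracket_pos k) (bracket_pos l)).le, ?_⟩
  have h : (k : ℝ) * l ≤ bracket k * bracket l :=
    (le_abs_self _).trans ((abs_mul _ _).le.trans
      (mul_le_mul (abs_le_bracket k) (abs_le_bracket l) (abs_nonneg _) (bracket_pos k).le))
  change bracket k ^ 2 = _ at hk
  change bracket l ^ 2 = _ at hl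
  push_cast
  nlinarith

theorem bracket_add_le_mul (k l : ℤ) : bracket (k + l) ≤ 2 * (bracket k * bracket l) := by
  have := bracket_add_le k l
  nlinarith [one_le_bracket k, one_le_bracket l, mul_nonneg (sub_nonneg.2 (one_le_bracket k))
    (sub_nonneg.2 (one_le_bracket l))]

theorem bracket_rpow_pos (k : ℤ) (p : ℝ) : 0 < bracket k ^ p := Real.rpow_pos_of_pos (bracket_pos k) p

theorem bracket_rpow_le_rpow (k : ℤ) {p q : ℝ} (h : p ≤ q) : bracket k ^ p ≤ bracket k ^ q :=
  Real.rpow_le_rpow_of_exponent_le (one_le_bracket k) h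

theorem summable_bracket_rpow {p : ℝ} (hp : 1 < p) : Summable fun k : ℤ => bracket k ^ (-p) := by
  refine (Real.summable_abs_int_rpow hp).of_norm_bounded_eventually ?_
  filter_upwards [(Set.finite_singleton (0 : ℤ)).compl_mem_cofinite] with k hk
  rw [Real.norm_of_nonneg (bracket_rpow_pos k _).le]
  exact Real.rpow_le_rpow_of_nonpos (abs_pos.2 (Int.cast_ne_zero.2 hk)) (abs_le_bracket k)
    (by linarith)

/-- The larger of ⟨k⟩, ⟨l⟩ is at least ⟨k+l⟩/2 and supplies the factor ⟨k+l⟩^{-q}. If it is ⟨k⟩, the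
surplus ⟨k⟩^{q-p} is at most ⟨l⟩^{q-p} because q ≤ p. What remains is a power -p of a single
bracket, summable along k + l = m as soon as p > 1. -/
theorem bracket_rpow_mul_rpow_le {p q : ℝ} (hq : 0 ≤ q) (hqp : q ≤ p) (k l : ℤ) :
    bracket k ^ (-p) * bracket l ^ (-q)
      ≤ 2 ^ (q + 1) * (bracket k ^ (-p) + bracket l ^ (-p)) * bracket (k + l) ^ (-q) := by
  have hk := bracket_pos k
  have hl := bracket_pos l
  have hm := bracket_pos (k + l)
  have key : bracket k ^ (-p) * bracket l ^ (-q) * bracket (k + l) ^ q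
      ≤ 2 ^ (q + 1) * (bracket k ^ (-p) + bracket l ^ (-p)) := by
    rcases le_total (bracket k) (bracket l) with h | h
    · have h1 : bracket (k + l) ^ q ≤ 2 ^ q * bracket l ^ q := by
        rw [← Real.mul_rpow (by norm_num) hl.le]
        exact Real.rpow_le_rpow hm.le (by linarith [bracket_add_le k l]) hq
      calc bracket k ^ (-p) * bracket l ^ (-q) * bracket (k + l) ^ q
          ≤ bracket k ^ (-p) * bracket l ^ (-q) * (2 ^ q * bracket l ^ q) := by gcongr
        _ = 2 ^ q * bracket k ^ (-p) := by
            rw [Real.rpow_neg hl.le]; field_simp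
        _ ≤ 2 ^ (q + 1) * (bracket k ^ (-p) + bracket l ^ (-p)) := by
            gcongr
            · norm_num
            · linarith
            · linarith [bracket_rpow_pos l (-p)]
    · have h1 : bracket (k + l) ^ q ≤ 2 ^ q * bracket k ^ q := by
        rw [← Real.mul_rpow (by norm_num) hk.le]
        exact Real.rpow_le_rpow hm.le (by linarith [bracket_add_le k l]) hq
      have h2 : bracket k ^ (q - p) ≤ bracket l ^ (q - p) :=
        Real.rpow_le_rpow_of_nonpos hl h (by linarith)
      calc bracket k ^ (-p) * bracket l ^ (-q) * bracket (k + l) ^ q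
          ≤ bracket k ^ (-p) * bracket l ^ (-q) * (2 ^ q * bracket k ^ q) := by gcongr
        _ = 2 ^ q * (bracket k ^ (q - p) * bracket l ^ (-q)) := by
            rw [sub_eq_add_neg, Real.rpow_add hk]; ring
        _ ≤ 2 ^ q * (bracket l ^ (q - p) * bracket l ^ (-q)) := by gcongr
        _ = 2 ^ q * bracket l ^ (-p) := by
            rw [← Real.rpow_add hl]; congr 2; ring
        _ ≤ 2 ^ (q + 1) * (bracket k ^ (-p) + bracket l ^ (-p)) := by
            gcongr
            · norm_num
            · linarith
            · linarith [bracket_rpow_pos k (-p)]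
  rw [Real.rpow_neg hm.le, ← div_eq_mul_inv, le_div_iff₀ (bracket_rpow_pos _ _)]
  exact key

/-- The exponential `e^{ikx}`. -/
def expi (k : ℤ) (x : ℝ) : ℂ := cexp (I * k * x)

theorem norm_expi (k : ℤ) (x : ℝ) : ‖expi k x‖ = 1 := by
  rw [expi, show I * (k : ℂ) * (x : ℂ) = ((k * x : ℝ) : ℂ) * I by push_cast; ring]
  exact norm_exp_ofReal_mul_I _

theorem expi_add (k l : ℤ) (x : ℝ) : expi (k + l) x = expi k x * expi l x := by
  rw [expi, expi, expi, ← Complex.exp_add]; push_cast; ring_nf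

theorem conj_expi (k : ℤ) (x : ℝ) : conj (expi k x) = expi (-k) x := by
  rw [expi, expi, ← Complex.exp_conj]; simp

theorem expi_zero (x : ℝ) : expi 0 x = 1 := by simp [expi]

theorem hasDerivAt_expi (k : ℤ) (x : ℝ) : HasDerivAt (expi k) (I * k * expi k x) x := by
  have h : HasDerivAt (fun x : ℝ => I * (k : ℂ) * (x : ℂ)) (I * k) x := by
    simpa using (Complex.ofRealCLM.hasDerivAt (x := x)).const_mul (I * (k : ℂ))
  exact h.cexp.congr_deriv (by rw [expi]; ring)

theorem contDiff_expi (k : ℤ) : ContDiff ℝ ∞ (expi k) := by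
  unfold expi
  exact Complex.contDiff_exp.comp (contDiff_const.mul Complex.ofRealCLM.contDiff)

theorem continuous_expi (k : ℤ) : Continuous (expi k) := by
  unfold expi; fun_prop

theorem periodic_expi (k : ℤ) : Function.Periodic (expi k) (2 * Real.pi) := by
  intro x
  rw [expi, expi, Complex.exp_eq_exp_iff_exists_int]
  exact ⟨k, by push_cast; ring⟩

/-- The sum of a trigonometric series. -/
def fseries (c : ℤ → ℂ) (x : ℝ) : ℂ := ∑' k, c k * expi k x

theorem summable_fseries {c : ℤ → ℂ} (hc : Summable fun k => ‖c k‖) (x : ℝ) :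
    Summable fun k => c k * expi k x :=
  Summable.of_norm (by simpa [norm_expi] using hc)

theorem summable_norm_fseries {c : ℤ → ℂ} (hc : Summable fun k => ‖c k‖) (x : ℝ) :
    Summable fun k => ‖c k * expi k x‖ := by simpa [norm_expi] using hc

theorem continuous_fseries {c : ℤ → ℂ} (hc : Summable fun k => ‖c k‖) : Continuous (fseries c) :=
  continuous_tsum (fun k => continuous_const.mul (continuous_expi k)) hc
    fun k x => by simp [norm_expi]

theorem periodic_fseries (c : ℤ → ℂ) : Function.Periodic (fseries c) (2 * Real.pi) := by
  intro x; simp only [fseries, periodic_expi _ x]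

/-- The convolution of two sequences. -/
def convCoeff (c d : ℤ → ℂ) (m : ℤ) : ℂ := ∑' k, c k * d (m - k)

/-- The bijection `(m, k) ↦ (k, m - k)` of `ℤ × ℤ`. -/
def shearEquiv : ℤ × ℤ ≃ ℤ × ℤ where
  toFun p := (p.2, p.1 - p.2)
  invFun p := (p.1 + p.2, p.1)
  left_inv p := by simp
  right_inv p := by simp

theorem summable_conv {c d : ℤ → ℂ} (hc : Summable fun k => ‖c k‖) (hd : Summable fun k => ‖d k‖) :
    Summable fun p : ℤ × ℤ => ‖c p.2 * d (p.1 - p.2)‖ := by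
  have h := (shearEquiv.summable_iff (f := fun p : ℤ × ℤ => ‖c p.1 * d p.2‖)).2
    (Summable.mul_norm hc hd)
  exact h

theorem summable_norm_convCoeff {c d : ℤ → ℂ} (hc : Summable fun k => ‖c k‖)
    (hd : Summable fun k => ‖d k‖) : Summable fun m => ‖convCoeff c d m‖ := by
  have h := summable_conv hc hd
  refine Summable.of_nonneg_of_le (fun _ => norm_nonneg _) (fun m => ?_) h.prod
  exact norm_tsum_le_tsum_norm (h.prod_factor m)

theorem fseries_mul {c d : ℤ → ℂ} (hc : Summable fun k => ‖c k‖) (hd : Summable fun k => ‖d k‖)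
    (x : ℝ) : fseries c x * fseries d x = fseries (convCoeff c d) x := by
  rw [fseries, fseries, tsum_mul_tsum_of_summable_norm (summable_norm_fseries hc x)
    (summable_norm_fseries hd x), ← shearEquiv.tsum_eq]
  have h : Summable fun p : ℤ × ℤ => c p.2 * d (p.1 - p.2) * expi p.1 x :=
    Summable.of_norm (by simpa [norm_expi] using summable_conv hc hd)
  have e : ∀ p : ℤ × ℤ, (c (shearEquiv p).1 * expi (shearEquiv p).1 x)
      * (d (shearEquiv p).2 * expi (shearEquiv p).2 x) = c p.2 * d (p.1 - p.2) * expi p.1 x := by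
    intro p
    have : expi p.1 x = expi p.2 x * expi (p.1 - p.2) x := by rw [← expi_add]; congr 1; ring
    rw [this]; simp only [shearEquiv, Equiv.coe_fn_mk]; ring
  simp_rw [e]
  rw [h.tsum_prod, fseries]
  simp_rw [tsum_mul_right, convCoeff]

theorem hasDerivAt_fseries {c : ℤ → ℂ} (hc : Summable fun k => bracket k * ‖c k‖) (x : ℝ) :
    HasDerivAt (fseries c) (fseries (fun k => I * k * c k) x) x := by
  have h0 : Summable fun k => c k * expi k x := Summable.of_norm_bounded hc fun k => by
    rw [norm_mul, norm_expi, mul_one]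
    exact le_mul_of_one_le_left (norm_nonneg _) (one_le_bracket k)
  have := hasDerivAt_tsum (y₀ := x) hc (g := fun k x => c k * expi k x)
    (g' := fun k x => I * k * c k * expi k x)
    (fun k y => by simpa [mul_comm, mul_left_comm, mul_assoc] using (hasDerivAt_expi k y).const_mul (c k))
    (fun k y => by
      rw [norm_mul, norm_expi, mul_one, norm_mul, norm_mul, norm_I, one_mul, Complex.norm_intCast]
      exact mul_le_mul_of_nonneg_right (abs_le_bracket k) (norm_nonneg _)) h0 x
  exact this

theorem integralTorus_expi (k : ℤ) : integralTorus (expi k) = if k = 0 then 1 else 0 := by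
  have hpi := Real.pi_pos.ne'
  split_ifs with h
  · subst h
    simp only [integralTorus, expi_zero, intervalIntegral.integral_const]
    rw [smul_smul]
    field_simp
    norm_num
  · have hk : I * (k : ℂ) ≠ 0 := mul_ne_zero I_ne_zero (by exact_mod_cast h)
    have e : ∫ x in (-Real.pi)..Real.pi, expi k x = 0 := by
      unfold expi
      rw [integral_exp_mul_complex hk]
      have := periodic_expi k (-Real.pi)
      unfold expi at this
      rw [show -Real.pi + 2 * Real.pi = Real.pi by ring] at this
      rw [this]; simp
    rw [integralTorus, e, smul_zero]

theorem integralTorus_fseries {c : ℤ → ℂ} (hc : Summable fun k => ‖c k‖) (n : ℤ) :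
    integralTorus (fun x => fseries c x * expi (-n) x) = c n := by
  have h := intervalIntegral.hasSum_intervalIntegral_of_summable_norm (a := -Real.pi) (b := Real.pi)
    (f := fun k => ⟨fun x => c k * expi (k - n) x, continuous_const.mul (continuous_expi _)⟩)
    (hc.of_nonneg_of_le (fun _ => norm_nonneg _) fun k => by
      rw [ContinuousMap.norm_le _ (norm_nonneg _)]
      intro x; simp [norm_expi])
  have h2 := (h.const_smul ((2 * Real.pi)⁻¹ : ℝ)).tsum_eq
  have e : ∀ x, fseries c x * expi (-n) x = ∑' k, c k * expi (k - n) x := by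
    intro x
    rw [fseries, ← tsum_mul_right]
    congr 1; ext k; rw [mul_assoc, ← expi_add]; rfl
  simp only [ContinuousMap.coe_mk] at h2
  rw [integralTorus]
  simp_rw [e]
  rw [← h2, tsum_eq_single n]
  · have := integralTorus_expi 0
    simp only [integralTorus, if_true] at this
    rw [intervalIntegral.integral_const_mul, ← mul_smul_comm, sub_self, this, mul_one]
  · intro k hk
    have := integralTorus_expi (k - n)
    rw [if_neg (sub_ne_zero.2 hk), integralTorus] at this
    rw [intervalIntegral.integral_const_mul, ← mul_smul_comm, this, mul_zero]

/-- `f` is an absolutely convergent trigonometric series whose coefficients are bounded by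
`M ⟨k⟩ ^ (-σ)`. -/
def HasDecay (σ M : ℝ) (f : ℝ → ℂ) : Prop :=
  ∃ c : ℤ → ℂ, (Summable fun k => ‖c k‖) ∧ (∀ k, ‖c k‖ ≤ M * bracket k ^ (-σ)) ∧ f = fseries c

/-! ### Calculus of coefficient decay -/

namespace HasDecay

variable {σ M A B p q : ℝ} {f g : ℝ → ℂ}

theorem continuous (h : HasDecay σ M f) : Continuous f := by
  obtain ⟨c, hc, -, rfl⟩ := h; exact continuous_fseries hc

theorem periodic (h : HasDecay σ M f) : Function.Periodic f (2 * Real.pi) := by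
  obtain ⟨c, hc, -, rfl⟩ := h; exact periodic_fseries c

theorem nonneg (h : HasDecay σ M f) : 0 ≤ M := by
  obtain ⟨c, hc, h, -⟩ := h
  have := (norm_nonneg _).trans (h 0)
  exact nonneg_of_mul_nonneg_left this (bracket_rpow_pos _ _)

theorem norm_integral_le (h : HasDecay σ M f) (n : ℤ) :
    ‖integralTorus (fun x => f x * expi (-n) x)‖ ≤ M * bracket n ^ (-σ) := by
  obtain ⟨c, hc, h, rfl⟩ := h
  rw [integralTorus_fseries hc]; exact h n

theorem mono (h : HasDecay p A f) (hqp : q ≤ p) (hAB : A ≤ B) : HasDecay q B f := by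
  have hA := h.nonneg
  obtain ⟨c, hc, h, rfl⟩ := h
  refine ⟨c, hc, fun k => (h k).trans ?_, rfl⟩
  have := bracket_rpow_le_rpow k (neg_le_neg hqp)
  have := (bracket_rpow_pos k (-p)).le
  gcongr
  exact hA.trans hAB

theorem add (hf : HasDecay σ A f) (hg : HasDecay σ B g) :
    HasDecay σ (A + B) (fun x => f x + g x) := by
  obtain ⟨c, hc, h, rfl⟩ := hf
  obtain ⟨d, hd, h', rfl⟩ := hg
  refine ⟨fun k => c k + d k, (hc.add hd).of_nonneg_of_le (fun _ => norm_nonneg _)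
    fun k => norm_add_le _ _, fun k => (norm_add_le _ _).trans ?_, ?_⟩
  · rw [add_mul]; exact add_le_add (h k) (h' k)
  · funext x
    simp only [fseries]
    rw [← (summable_fseries hc x).tsum_add (summable_fseries hd x)]
    simp only [add_mul]

theorem const_mul (hf : HasDecay σ A f) (a : ℂ) : HasDecay σ (‖a‖ * A) (fun x => a * f x) := by
  obtain ⟨c, hc, h, rfl⟩ := hf
  refine ⟨fun k => a * c k, by simpa using hc.mul_left ‖a‖, fun k => ?_, ?_⟩
  · rw [norm_mul, mul_assoc]; exact mul_le_mul_of_nonneg_left (h k) (norm_nonneg _)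
  · funext x; simp only [fseries, mul_assoc, tsum_mul_left]

theorem const (σ : ℝ) (a : ℂ) : HasDecay σ ‖a‖ (fun _ => a) := by
  refine ⟨fun k => if k = 0 then a else 0, ?_, fun k => ?_, ?_⟩
  · exact summable_of_hasFiniteSupport ((Set.finite_singleton (0 : ℤ)).subset fun k hk => by
      by_contra h; simp at h; simp [h] at hk)
  · by_cases h : k = 0
    · subst h; simp [bracket]
    · simpa [h] using mul_nonneg (norm_nonneg a) (bracket_rpow_pos k _).le
  · funext x
    rw [fseries, tsum_eq_single 0 (fun k hk => by simp [hk])]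
    simp [expi_zero]

theorem conj_apply (hf : HasDecay σ A f) : HasDecay σ A (fun x => conj (f x)) := by
  obtain ⟨c, hc, h, rfl⟩ := hf
  refine ⟨fun k => conj (c (-k)), ?_, fun k => ?_, ?_⟩
  · simp only [RCLike.norm_conj]
    exact (Equiv.neg ℤ).summable_iff.2 hc
  · simpa [bracket_neg] using h (-k)
  · funext x
    rw [fseries, Complex.conj_tsum, fseries, ← (Equiv.neg ℤ).tsum_eq]
    simp [conj_expi]

/-- The coefficients of the product are a convolution, estimated by `bracket_rpow_mul_rpow_le`. Only
the better factor needs p > 1; the order q may be below 1, as happens for second derivatives, of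
order s - 2. The constant is chosen before the functions, so that later estimates are uniform in the
solution. -/
theorem exists_mul (hp : 1 < p) (hq : 0 ≤ q) (hqp : q ≤ p) : ∃ C : ℝ, 0 ≤ C ∧
    ∀ {f g : ℝ → ℂ} {A B : ℝ}, HasDecay p A f → HasDecay q B g →
      HasDecay q (C * (A * B)) (fun x => f x * g x) := by
  set S := ∑' k : ℤ, bracket k ^ (-p) with hS
  have hs := summable_bracket_rpow hp
  have hS0 : 0 ≤ S := tsum_nonneg fun k => (bracket_rpow_pos k _).le
  refine ⟨2 ^ (q + 1) * (S + S), by positivity, ?_⟩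
  intro f g A B hf hg
  have hA := hf.nonneg
  have hB := hg.nonneg
  obtain ⟨c, hc, h, rfl⟩ := hf
  obtain ⟨d, hd, h', rfl⟩ := hg
  refine ⟨convCoeff c d, summable_norm_convCoeff hc hd, fun m => ?_, ?_⟩
  · have hs' : Summable fun k : ℤ => bracket (m - k) ^ (-p) :=
      (Equiv.subLeft m).summable_iff.2 hs
    have e' : ∑' k : ℤ, bracket (m - k) ^ (-p) = S :=
      (Equiv.subLeft m).tsum_eq fun k => bracket k ^ (-p)
    have hsum := ((hs.hasSum.add hs'.hasSum).mul_left (A * B * 2 ^ (q + 1))).mul_right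
      (bracket m ^ (-q))
    rw [e'] at hsum
    have hn := (summable_conv hc hd).prod_factor m
    refine (norm_tsum_le_tsum_norm hn).trans ((hn.tsum_le_tsum (fun k => ?_) hsum.summable).trans
      (hsum.tsum_eq.trans_le (le_of_eq (by ring))))
    have h3 := bracket_rpow_mul_rpow_le hq hqp k (m - k)
    rw [add_sub_cancel] at h3
    calc ‖c k * d (m - k)‖ = ‖c k‖ * ‖d (m - k)‖ := norm_mul _ _
      _ ≤ (A * bracket k ^ (-p)) * (B * bracket (m - k) ^ (-q)) :=
          mul_le_mul (h k) (h' _) (norm_nonneg _) ((norm_nonneg _).trans (h k))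
      _ = A * B * (bracket k ^ (-p) * bracket (m - k) ^ (-q)) := by ring
      _ ≤ A * B * (2 ^ (q + 1) * (bracket k ^ (-p) + bracket (m - k) ^ (-p)) * bracket m ^ (-q)) := by
          gcongr
      _ = _ := by ring
  · funext x; exact fseries_mul hc hd x

end HasDecay

end

/-! ### Integration over the torus and smooth periodic functions -/

section

theorem integralTorus_add {f g : ℝ → ℂ} (hf : Continuous f) (hg : Continuous g) :
    integralTorus (fun x => f x + g x) = integralTorus f + integralTorus g := by
  rw [integralTorus, intervalIntegral.integral_add (hf.intervalIntegrable _ _)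
    (hg.intervalIntegrable _ _), smul_add]; rfl

theorem integralTorus_const_mul (a : ℂ) (f : ℝ → ℂ) :
    integralTorus (fun x => a * f x) = a * integralTorus f := by
  rw [integralTorus, intervalIntegral.integral_const_mul, ← mul_smul_comm]; rfl

theorem integralTorus_sub {f g : ℝ → ℂ} (hf : Continuous f) (hg : Continuous g) :
    integralTorus (fun x => f x - g x) = integralTorus f - integralTorus g := by
  rw [integralTorus, intervalIntegral.integral_sub (hf.intervalIntegrable _ _)
    (hg.intervalIntegrable _ _), smul_sub]; rfl

theorem integralTorus_neg (f : ℝ → ℂ) : integralTorus (fun x => - f x) = - integralTorus f := by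
  rw [integralTorus, intervalIntegral.integral_neg, smul_neg]; rfl

theorem integralTorus_conj (f : ℝ → ℂ) :
    integralTorus (fun x => conj (f x)) = conj (integralTorus f) := by
  have : ∫ x in (-Real.pi)..Real.pi, conj (f x) = conj (∫ x in (-Real.pi)..Real.pi, f x) := by
    simp only [intervalIntegral, integral_conj, map_sub]
  rw [integralTorus, this, integralTorus, Complex.real_smul, Complex.real_smul, map_mul,
    Complex.conj_ofReal]

theorem norm_integralTorus_le {f : ℝ → ℂ} {M : ℝ} (h : ∀ x, ‖f x‖ ≤ M) :
    ‖integralTorus f‖ ≤ M := by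
  have := intervalIntegral.norm_integral_le_of_norm_le_const (f := f) (a := -Real.pi) (b := Real.pi)
    (C := M) (fun x _ => h x)
  have hpi := Real.pi_pos
  rw [integralTorus, norm_smul, norm_inv, Real.norm_of_nonneg (by positivity),
    inv_mul_le_iff₀ (by positivity)]
  rw [show Real.pi - -Real.pi = 2 * Real.pi by ring, abs_of_pos (by positivity)] at this
  linarith

theorem integralTorus_im {f : ℝ → ℂ} (hf : Continuous f) :
    integralTorus (fun x => (f x).im) = (integralTorus f).im := by
  have := Complex.imCLM.intervalIntegral_comp_comm (hf.intervalIntegrable (μ := volume) (-Real.pi) Real.pi)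
  simp only [Complex.imCLM_apply] at this
  rw [integralTorus, this, integralTorus]
  simp

theorem integralTorus_deriv_mul {f f' g g' : ℝ → ℂ} (hf : ∀ x, HasDerivAt f (f' x) x)
    (hg : ∀ x, HasDerivAt g (g' x) x) (hf' : Continuous f') (hg' : Continuous g')
    (pf : Function.Periodic f (2 * Real.pi)) (pg : Function.Periodic g (2 * Real.pi)) :
    integralTorus (fun x => f' x * g x) = - integralTorus (fun x => f x * g' x) := by
  have h := intervalIntegral.integral_mul_deriv_eq_deriv_mul (a := -Real.pi) (b := Real.pi)
    (fun x _ => hf x) (fun x _ => hg x) (hf'.intervalIntegrable _ _) (hg'.intervalIntegrable _ _)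
  have e1 := pf (-Real.pi)
  have e2 := pg (-Real.pi)
  rw [show -Real.pi + 2 * Real.pi = Real.pi by ring] at e1 e2
  rw [e1, e2, sub_self, zero_sub] at h
  rw [integralTorus, integralTorus, h, smul_neg, neg_neg]

/-- Smooth `2π`-periodic functions. -/
structure SmoothPeriodic (f : ℝ → ℂ) : Prop where
  contDiff : ContDiff ℝ ∞ f
  periodic : Function.Periodic f (2 * Real.pi)

namespace SmoothPeriodic

variable {f g : ℝ → ℂ}

theorem continuous (hf : SmoothPeriodic f) : Continuous f := hf.contDiff.continuous

theorem differentiable (hf : SmoothPeriodic f) : Differentiable ℝ f :=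
  hf.contDiff.differentiable (by simp)

theorem hasDerivAt (hf : SmoothPeriodic f) (x : ℝ) : HasDerivAt f (deriv f x) x :=
  (hf.differentiable x).hasDerivAt

theorem deriv (hf : SmoothPeriodic f) : SmoothPeriodic (deriv f) where
  contDiff := (contDiff_infty_iff_deriv.1 hf.contDiff).2
  periodic x := by
    rw [← deriv_comp_add_const]
    congr 1; funext y; exact hf.periodic y

theorem add (hf : SmoothPeriodic f) (hg : SmoothPeriodic g) : SmoothPeriodic (fun x => f x + g x) :=
  ⟨hf.contDiff.add hg.contDiff, fun x => by simp only [hf.periodic x, hg.periodic x]⟩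

theorem mul (hf : SmoothPeriodic f) (hg : SmoothPeriodic g) : SmoothPeriodic (fun x => f x * g x) :=
  ⟨hf.contDiff.mul hg.contDiff, fun x => by simp only [hf.periodic x, hg.periodic x]⟩

theorem const (a : ℂ) : SmoothPeriodic (fun _ => a) := ⟨contDiff_const, fun _ => rfl⟩

theorem const_mul (a : ℂ) (hf : SmoothPeriodic f) : SmoothPeriodic (fun x => a * f x) :=
  (const a).mul hf

theorem neg (hf : SmoothPeriodic f) : SmoothPeriodic (fun x => - f x) :=
  ⟨hf.contDiff.neg, fun x => by simp only [hf.periodic x]⟩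

theorem conj_apply (hf : SmoothPeriodic f) : SmoothPeriodic (fun x => conj (f x)) :=
  ⟨Complex.conjCLE.contDiff.comp hf.contDiff, fun x => by simp only [hf.periodic x]⟩

theorem exp_apply (hf : SmoothPeriodic f) : SmoothPeriodic (fun x => Complex.exp (f x)) :=
  ⟨hf.contDiff.cexp, fun x => by simp only [hf.periodic x]⟩

theorem expi (k : ℤ) : SmoothPeriodic (expi k) := ⟨contDiff_expi k, periodic_expi k⟩

theorem exists_bound (hf : SmoothPeriodic f) : ∃ M, ∀ x, ‖f x‖ ≤ M := by
  obtain ⟨M, hM⟩ := (isCompact_Icc (a := (0 : ℝ)) (b := 0 + 2 * Real.pi)).exists_bound_of_continuousOn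
    hf.continuous.continuousOn
  refine ⟨M, fun x => ?_⟩
  obtain ⟨y, hy, e⟩ := hf.periodic.exists_mem_Ico₀ Real.two_pi_pos x
  rw [e]
  exact hM y ⟨hy.1, by linarith [hy.2]⟩

/-- Integration by parts trades a factor k for a derivative, and ⟨k⟩ ≤ 1 + |k|; the induction runs
over all smooth functions, so that it applies to f' as well. -/
theorem exists_coeff_bound (N : ℕ) : ∀ {f : ℝ → ℂ}, SmoothPeriodic f → ∃ M, ∀ k,
    ‖integralTorus (fun x => f x * PeriodicNLS.expi (-k) x)‖ * bracket k ^ N ≤ M := by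
  induction N with
  | zero =>
    intro f hf
    obtain ⟨M, hM⟩ := hf.exists_bound
    refine ⟨M, fun k => ?_⟩
    rw [pow_zero, mul_one]
    exact norm_integralTorus_le fun x => by simpa [norm_expi] using hM x
  | succ N ih =>
    intro f hf
    obtain ⟨M, hM⟩ := ih hf
    obtain ⟨M', hM'⟩ := ih hf.deriv
    refine ⟨M + M', fun k => ?_⟩
    have h := integralTorus_deriv_mul hf.hasDerivAt (hasDerivAt_expi (-k)) hf.deriv.continuous
      (continuous_const.mul (continuous_expi _)) hf.periodic (periodic_expi _)
    have e : (fun x => f x * (I * ((-k : ℤ) : ℂ) * PeriodicNLS.expi (-k) x))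
        = fun x => (-I * k) * (f x * PeriodicNLS.expi (-k) x) := by
      funext x; push_cast; ring
    rw [e, integralTorus_const_mul] at h
    have h1 := hM k
    have h2 := hM' k
    rw [h, norm_neg, norm_mul, norm_mul, norm_neg, norm_I, one_mul, Complex.norm_intCast] at h2
    have h3 := bracket_le_one_add_abs k
    have h4 : 0 ≤ ‖integralTorus (fun x => f x * PeriodicNLS.expi (-k) x)‖ * bracket k ^ N :=
      mul_nonneg (norm_nonneg _) (pow_nonneg (bracket_pos k).le _)
    rw [pow_succ]
    nlinarith

theorem exists_hasDecay (hf : SmoothPeriodic f) (σ : ℝ) : ∃ M, HasDecay σ M f := by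
  have key : ∀ {f : ℝ → ℂ}, SmoothPeriodic f → ∀ σ : ℝ, ∃ M, ∀ k,
      ‖integralTorus (fun x => f x * PeriodicNLS.expi (-k) x)‖ ≤ M * bracket k ^ (-σ) := by
    intro f hf σ
    obtain ⟨N, hN⟩ := exists_nat_ge σ
    obtain ⟨M, hM⟩ := exists_coeff_bound N hf
    refine ⟨M, fun k => ?_⟩
    rw [Real.rpow_neg (bracket_pos k).le, ← div_eq_mul_inv, le_div_iff₀ (bracket_rpow_pos _ _)]
    refine le_trans ?_ (hM k)
    gcongr
    exact (bracket_rpow_le_rpow k hN).trans_eq (Real.rpow_natCast _ _)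
  obtain ⟨M, hM⟩ := key hf σ
  -- Order 2 > 1 makes the coefficients summable, whatever the order σ that is claimed.
  obtain ⟨M2, hM2⟩ := key hf 2
  have hs : Summable fun k => ‖integralTorus (fun x => f x * PeriodicNLS.expi (-k) x)‖ :=
    ((summable_bracket_rpow one_lt_two).mul_left M2).of_nonneg_of_le (fun _ => norm_nonneg _) hM2
  refine ⟨M, _, hs, hM, ?_⟩
  let F : C(Torus, ℂ) := ⟨hf.periodic.lift, continuous_coinduced_dom.2 hf.continuous⟩
  have hF : ∀ k, fourierCoeff F k = integralTorus (fun x => f x * PeriodicNLS.expi (-k) x) := by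
    intro k
    rw [fourierCoeff_eq_intervalIntegral _ _ (-Real.pi), integralTorus,
      show -Real.pi + 2 * Real.pi = Real.pi by ring, one_div]
    congr 2
    funext x
    have : (F (x : Torus)) = f x := rfl
    rw [this, fourier_coe_apply, smul_eq_mul, mul_comm, PeriodicNLS.expi]
    congr 2
    have := Real.pi_pos.ne'
    have h2 : (Real.pi : ℂ) ≠ 0 := by exact_mod_cast this
    push_cast
    field_simp
  funext x
  have := has_pointwise_sum_fourier_series_of_summable (f := F)
    (Summable.of_norm (by simpa only [hF] using hs)) (x : Torus)
  rw [show f x = F (x : Torus) from rfl, ← this.tsum_eq, fseries]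
  congr 1; funext k
  rw [hF, fourier_coe_apply, smul_eq_mul, PeriodicNLS.expi]
  congr 2
  have := Real.pi_pos.ne'
  have h2 : (Real.pi : ℂ) ≠ 0 := by exact_mod_cast this
  push_cast
  field_simp

end SmoothPeriodic

/-! ### Polynomial nonlinearities: derivatives and decay -/

theorem hasDerivAt_eval_mvPolynomial (F : MvPolynomial (Fin 4) ℂ) {z : ℝ → Fin 4 → ℂ}
    {z' : Fin 4 → ℂ} {x : ℝ} (h : ∀ i, HasDerivAt (fun x => z x i) (z' i) x) :
    HasDerivAt (fun x => MvPolynomial.eval (z x) F)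
      (∑ i, MvPolynomial.eval (z x) (MvPolynomial.pderiv i F) * z' i) x := by
  induction F using MvPolynomial.induction_on with
  | C a => simpa using hasDerivAt_const x a
  | add p q hp hq =>
    simp only [map_add, add_mul, Finset.sum_add_distrib]
    exact hp.add hq
  | mul_X p i hp =>
    have := hp.mul (h i)
    simp only [map_mul, MvPolynomial.eval_X]
    refine this.congr_deriv ?_
    simp only [Derivation.leibniz, smul_eq_mul, map_add, map_mul, MvPolynomial.eval_X, add_mul,
      Finset.sum_add_distrib, MvPolynomial.pderiv_X]
    rw [add_comm, Finset.sum_mul]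
    congr 1
    · rw [Finset.sum_eq_single i]
      · simp
      · intro j _ hj; simp [hj.symm]
      · simp
    · exact Finset.sum_congr rfl fun j _ => by ring

theorem hasDerivAt_evalPoly (F : MvPolynomial (Fin 4) ℂ) {f g : ℝ → ℂ} {f' g' : ℂ} {x : ℝ}
    (hf : HasDerivAt f f' x) (hg : HasDerivAt g g' x) :
    HasDerivAt (fun x => evalPoly F (f x) (g x))
      (evalPoly (MvPolynomial.pderiv 0 F) (f x) (g x) * f'
        + evalPoly (MvPolynomial.pderiv 1 F) (f x) (g x) * g'
        + evalPoly (MvPolynomial.pderiv 2 F) (f x) (g x) * conj f'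
        + evalPoly (MvPolynomial.pderiv 3 F) (f x) (g x) * conj g') x := by
  have hc : ∀ {f : ℝ → ℂ} {f' : ℂ}, HasDerivAt f f' x →
      HasDerivAt (fun x => conj (f x)) (conj f') x := fun h =>
    Complex.conjCLE.toContinuousLinearMap.hasFDerivAt.comp_hasDerivAt x h
  have := hasDerivAt_eval_mvPolynomial F (z := fun x => ![f x, g x, conj (f x), conj (g x)])
    (z' := ![f', g', conj f', conj g']) (x := x) (by
      intro i
      fin_cases i
      exacts [hf, hg, hc hf, hc hg])
  simpa [Fin.sum_univ_four, evalPoly] using this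

/-- Moving β in the directions 1 and i yields F₁ + F₃ and i(F₁ - F₃), where F₁, F₃ are the formal
derivatives in the variables β and conj β. In (1/2)(∂_a - i∂_b) the F₃ terms cancel. -/
theorem evalPolyBeta_eq (F : MvPolynomial (Fin 4) ℂ) (α β : ℂ) :
    evalPolyBeta F α β = evalPoly (MvPolynomial.pderiv 1 F) α β := by
  have h1 : HasDerivAt (fun a : ℝ => β + (a : ℂ)) 1 0 := by
    simpa using (Complex.ofRealCLM.hasDerivAt (x := 0)).const_add β
  have h2 : HasDerivAt (fun a : ℝ => β + (a : ℂ) * I) I 0 := by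
    simpa using ((Complex.ofRealCLM.hasDerivAt (x := 0)).mul_const I).const_add β
  rw [evalPolyBeta, (hasDerivAt_evalPoly F (hasDerivAt_const _ α) h1).deriv,
    (hasDerivAt_evalPoly F (hasDerivAt_const _ α) h2).deriv]
  simp
  ring_nf
  simp
  ring

theorem SmoothPeriodic.evalPoly (F : MvPolynomial (Fin 4) ℂ) {f g : ℝ → ℂ} (hf : SmoothPeriodic f)
    (hg : SmoothPeriodic g) : SmoothPeriodic (fun x => evalPoly F (f x) (g x)) := by
  unfold PeriodicNLS.evalPoly
  induction F using MvPolynomial.induction_on with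
  | C a => simpa using SmoothPeriodic.const a
  | add p q hp hq => simpa using hp.add hq
  | mul_X p i hp =>
    simp only [map_mul, MvPolynomial.eval_X]
    refine hp.mul ?_
    fin_cases i
    exacts [hf, hg, hf.conj_apply, hg.conj_apply]

theorem continuous_evalPoly (F : MvPolynomial (Fin 4) ℂ) :
    Continuous fun p : ℂ × ℂ => evalPoly F p.1 p.2 := by
  unfold PeriodicNLS.evalPoly
  refine (MvPolynomial.continuous_eval F).comp (continuous_pi fun i => ?_)
  fin_cases i
  exacts [continuous_fst, continuous_snd, Complex.continuous_conj.comp continuous_fst,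
    Complex.continuous_conj.comp continuous_snd]

theorem exists_hasDecay_evalPoly (F : MvPolynomial (Fin 4) ℂ) {p M : ℝ} (hp : 1 < p) :
    ∃ C : ℝ, 0 ≤ C ∧ ∀ {f g : ℝ → ℂ}, HasDecay p M f → HasDecay p M g →
      HasDecay p C (fun x => evalPoly F (f x) (g x)) := by
  unfold PeriodicNLS.evalPoly
  induction F using MvPolynomial.induction_on with
  | C a => exact ⟨‖a‖, norm_nonneg a, fun _ _ => by simpa using HasDecay.const p a⟩
  | add F G hF hG =>
    obtain ⟨A, hA, hF⟩ := hF
    obtain ⟨B, hB, hG⟩ := hG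
    exact ⟨A + B, by positivity, fun hf hg => by simpa using (hF hf hg).add (hG hf hg)⟩
  | mul_X F i hF =>
    obtain ⟨A, hA, hF⟩ := hF
    obtain ⟨K, hK, h⟩ := HasDecay.exists_mul hp (by linarith : 0 ≤ p) le_rfl
    refine ⟨K * (A * |M|), by positivity, fun {f g} hf hg => ?_⟩
    have hi : HasDecay p |M| (fun x => ![f x, g x, conj (f x), conj (g x)] i) := by
      fin_cases i
      exacts [hf.mono le_rfl (le_abs_self _), hg.mono le_rfl (le_abs_self _),
        hf.conj_apply.mono le_rfl (le_abs_self _), hg.conj_apply.mono le_rfl (le_abs_self _)]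
    simpa using h (hF hf hg) hi

theorem exists_hasDecay_evalPoly_sub (F : MvPolynomial (Fin 4) ℂ) {p M : ℝ} (hp : 1 < p) :
    ∃ C : ℝ, 0 ≤ C ∧ ∀ {f g f₀ g₀ : ℝ → ℂ} {δ : ℝ}, HasDecay p M f → HasDecay p M g →
      HasDecay p M f₀ → HasDecay p M g₀ → HasDecay p δ (fun x => f x - f₀ x) →
      HasDecay p δ (fun x => g x - g₀ x) →
      HasDecay p (C * δ) (fun x => evalPoly F (f x) (g x) - evalPoly F (f₀ x) (g₀ x)) := by
  induction F using MvPolynomial.induction_on with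
  | C a =>
    refine ⟨0, le_rfl, fun _ _ _ _ _ _ => ?_⟩
    simpa [evalPoly] using HasDecay.const p 0
  | add F G hF hG =>
    obtain ⟨A, hA, hF⟩ := hF
    obtain ⟨B, hB, hG⟩ := hG
    refine ⟨A + B, by positivity, fun h1 h2 h3 h4 h5 h6 => ?_⟩
    convert (hF h1 h2 h3 h4 h5 h6).add (hG h1 h2 h3 h4 h5 h6) using 1
    · ring
    · funext x; simp [evalPoly]; ring
  | mul_X F i hF =>
    obtain ⟨A, hA, hF⟩ := hF
    obtain ⟨B, hB, hB'⟩ := exists_hasDecay_evalPoly F (M := M) hp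
    obtain ⟨K, hK, h⟩ := HasDecay.exists_mul hp (by linarith : 0 ≤ p) le_rfl
    refine ⟨K * (A * |M|) + K * B, by positivity, fun {f g f₀ g₀ δ} h1 h2 h3 h4 h5 h6 => ?_⟩
    have hi : HasDecay p |M| (fun x => ![f x, g x, conj (f x), conj (g x)] i) := by
      fin_cases i
      exacts [h1.mono le_rfl (le_abs_self _), h2.mono le_rfl (le_abs_self _),
        h1.conj_apply.mono le_rfl (le_abs_self _), h2.conj_apply.mono le_rfl (le_abs_self _)]
    have hd : HasDecay p δ (fun x => ![f x, g x, conj (f x), conj (g x)] i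
        - ![f₀ x, g₀ x, conj (f₀ x), conj (g₀ x)] i) := by
      fin_cases i
      exacts [h5, h6, by simpa using h5.conj_apply, by simpa using h6.conj_apply]
    -- The telescoping identity PX - P₀X₀ = (P - P₀)X + P₀(X - X₀).
    convert (h (hF h1 h2 h3 h4 h5 h6) hi).add (h (hB' h3 h4) hd) using 1
    · ring
    · funext x; simp [evalPoly]; ring

end

/-! ### Elements of `H^s` as continuous Fourier series -/

section

namespace Sobolev

variable {s : ℝ}

/-- The Fourier coefficients of an element of `H^s`. -/
def coef (u : Sobolev s) (k : ℤ) : ℂ := fourierCoeff (toL2 u : Torus → ℂ) k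

theorem coef_eq_repr (u : Sobolev s) (k : ℤ) : coef u k = fourierBasis.repr (toL2 u) k :=
  fourierCoeff_eq_repr _ k

theorem coef_add (u v : Sobolev s) (k : ℤ) : coef (u + v) k = coef u k + coef v k := by
  simp only [coef_eq_repr, map_add]; rfl

theorem coef_sub (u v : Sobolev s) (k : ℤ) : coef (u - v) k = coef u k - coef v k := by
  simp only [coef_eq_repr, map_sub]; rfl

theorem toSeq_apply (u : Sobolev s) (k : ℤ) :
    toSeq u k = ((bracket k ^ s : ℝ) : ℂ) * coef u k := rfl

theorem norm_toSeq (u : Sobolev s) : ‖toSeq u‖ = ‖u‖ := rfl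

theorem norm_toSeq_apply (u : Sobolev s) (k : ℤ) : ‖toSeq u k‖ = bracket k ^ s * ‖coef u k‖ := by
  rw [toSeq_apply, norm_mul, Complex.norm_real, Real.norm_of_nonneg (bracket_rpow_pos k s).le]

theorem norm_coef_le (u : Sobolev s) (k : ℤ) : ‖coef u k‖ ≤ ‖u‖ * bracket k ^ (-s) := by
  have h := lp.norm_apply_le_norm (p := 2) (by norm_num) (toSeq u) k
  rw [norm_toSeq_apply, norm_toSeq] at h
  rwa [Real.rpow_neg (bracket_pos k).le, ← div_eq_mul_inv, le_div_iff₀ (bracket_rpow_pos _ _),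
    mul_comm]

/-- Cauchy–Schwarz for ⟨k⟩^{a-s} and ⟨k⟩^s|û(k)|; the first sequence is square summable because 2(s
- a) > 1. -/
theorem exists_tsum_le {a : ℝ} (ha : a + 1 / 2 < s) : ∃ C : ℝ, 0 ≤ C ∧ ∀ u : Sobolev s,
    (Summable fun k => bracket k ^ a * ‖coef u k‖) ∧
      ∑' k, bracket k ^ a * ‖coef u k‖ ≤ C * ‖u‖ := by
  have hs : Summable fun k : ℤ => (bracket k ^ (a - s)) ^ (2 : ℝ) := by
    have := summable_bracket_rpow (p := 2 * (s - a)) (by linarith)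
    refine this.congr fun k => ?_
    rw [← Real.rpow_mul (bracket_pos k).le]
    congr 1; ring
  refine ⟨(∑' k : ℤ, (bracket k ^ (a - s)) ^ (2 : ℝ)) ^ (1 / (2 : ℝ)),
    Real.rpow_nonneg (tsum_nonneg fun k => Real.rpow_nonneg (bracket_rpow_pos k _).le _) _,
    fun u => ?_⟩
  have hn := lp.hasSum_norm (p := 2) (by norm_num) (toSeq u)
  simp only [ENNReal.toReal_ofNat, norm_toSeq] at hn
  have h := Real.summable_and_inner_le_Lp_mul_Lq_tsum_of_nonneg (p := 2) (q := 2)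
    Real.HolderConjugate.two_two (f := fun k : ℤ => bracket k ^ (a - s))
    (g := fun k => ‖toSeq u k‖) (fun k => (bracket_rpow_pos k _).le) (fun k => norm_nonneg _) hs
    hn.summable
  have e : (∑' k, ‖toSeq u k‖ ^ (2 : ℝ)) ^ (1 / (2 : ℝ)) = ‖u‖ := by
    rw [hn.tsum_eq, ← Real.rpow_mul (norm_nonneg _)]; norm_num
  rw [e] at h
  have e' : ∀ k, bracket k ^ (a - s) * ‖toSeq u k‖ = bracket k ^ a * ‖coef u k‖ := by
    intro k
    rw [norm_toSeq_apply, ← mul_assoc, ← Real.rpow_add (bracket_pos k)]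
    congr 2; ring
  simpa only [e'] using h

/-- The `j`-th derivative of an element of `H^s`, as the sum of its Fourier series. -/
def dfun (j : ℕ) (u : Sobolev s) : ℝ → ℂ := fseries fun k => (I * k) ^ j * coef u k

theorem norm_dcoef_le (j : ℕ) (u : Sobolev s) (k : ℤ) :
    ‖(I * (k : ℂ)) ^ j * coef u k‖ ≤ bracket k ^ j * ‖coef u k‖ := by
  rw [norm_mul, norm_pow, norm_mul, norm_I, one_mul, Complex.norm_intCast]
  gcongr
  exact abs_le_bracket k

theorem summable_dcoef {j : ℕ} (hj : (j : ℝ) + 1 / 2 < s) (u : Sobolev s) :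
    Summable fun k : ℤ => ‖(I * (k : ℂ)) ^ j * coef u k‖ := by
  obtain ⟨C, -, h⟩ := exists_tsum_le hj
  refine (h u).1.of_nonneg_of_le (fun _ => norm_nonneg _) fun k => ?_
  simpa using norm_dcoef_le j u k

theorem dfun_sub {j : ℕ} (hj : (j : ℝ) + 1 / 2 < s) (u v : Sobolev s) (x : ℝ) :
    dfun j (u - v) x = dfun j u x - dfun j v x := by
  simp only [dfun, fseries]
  rw [← (summable_fseries (summable_dcoef hj u) x).tsum_sub
    (summable_fseries (summable_dcoef hj v) x)]
  congr 1; funext k; rw [coef_sub]; ring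

theorem exists_norm_dfun_le {j : ℕ} (hj : (j : ℝ) + 1 / 2 < s) : ∃ C : ℝ, 0 ≤ C ∧
    ∀ (u : Sobolev s) x, ‖dfun j u x‖ ≤ C * ‖u‖ := by
  obtain ⟨C, hC, h⟩ := exists_tsum_le hj
  refine ⟨C, hC, fun u x => le_trans ?_ (h u).2⟩
  have h1 := summable_norm_fseries (summable_dcoef hj u) x
  refine (norm_tsum_le_tsum_norm h1).trans (h1.tsum_le_tsum (fun k => ?_) (h u).1)
  rw [norm_mul, norm_expi, mul_one]
  simpa using norm_dcoef_le j u k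

theorem continuous_dfun_uncurry {j : ℕ} (hj : (j : ℝ) + 1 / 2 < s) :
    Continuous fun p : Sobolev s × ℝ => dfun j p.1 p.2 := by
  obtain ⟨C, hC, h⟩ := exists_norm_dfun_le hj
  refine continuous_prod_of_continuous_lipschitzWith _ C.toNNReal
    (fun u => continuous_fseries (summable_dcoef hj u)) fun x => LipschitzWith.of_dist_le_mul
      fun u v => ?_
  rw [dist_eq_norm, dist_eq_norm, ← dfun_sub hj, Real.coe_toNNReal C hC]
  exact h _ x

/-- Absolute convergence comes from membership in H^s and the decay from the hypothesis alone, so M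
may be much smaller than the norm of u. This is how closeness in a weaker norm is exploited. -/
theorem hasDecay_dfun {j : ℕ} (hj : (j : ℝ) + 1 / 2 < s) {u : Sobolev s} {σ M : ℝ}
    (h : ∀ k, ‖coef u k‖ ≤ M * bracket k ^ (-(σ + j))) : HasDecay σ M (dfun j u) := by
  refine ⟨_, summable_dcoef hj u, fun k => (norm_dcoef_le j u k).trans ?_, rfl⟩
  calc bracket k ^ j * ‖coef u k‖ ≤ bracket k ^ j * (M * bracket k ^ (-(σ + j))) := by
        gcongr
        exacts [pow_nonneg (bracket_pos k).le j, h k]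
    _ = M * bracket k ^ (-σ) := by
        rw [← Real.rpow_natCast, mul_left_comm, ← Real.rpow_add (bracket_pos k)]
        congr 2; ring

theorem hasDecay_dfun_norm {j : ℕ} (hj : (j : ℝ) + 1 / 2 < s) (u : Sobolev s) :
    HasDecay (s - j) ‖u‖ (dfun j u) :=
  hasDecay_dfun hj (by simpa using norm_coef_le u)

theorem hasDerivAt_dfun {j : ℕ} (hj : ((j + 1 : ℕ) : ℝ) + 1 / 2 < s) (u : Sobolev s) (x : ℝ) :
    HasDerivAt (dfun j u) (dfun (j + 1) u x) x := by
  obtain ⟨C, -, h⟩ := exists_tsum_le hj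
  have hs : Summable fun k : ℤ => bracket k * ‖(I * (k : ℂ)) ^ j * coef u k‖ := by
    refine (h u).1.of_nonneg_of_le
      (fun k => mul_nonneg (bracket_pos k).le (norm_nonneg _)) fun k => ?_
    rw [Real.rpow_natCast, pow_succ', mul_assoc]
    exact mul_le_mul_of_nonneg_left (norm_dcoef_le j u k) (bracket_pos k).le
  refine (hasDerivAt_fseries hs x).congr_deriv (congrArg (fun c => fseries c x) (funext fun k => ?_))
  ring

theorem periodic_dfun (j : ℕ) (u : Sobolev s) : Function.Periodic (dfun j u) (2 * Real.pi) :=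
  periodic_fseries _

theorem continuous_dfun {j : ℕ} (hj : (j : ℝ) + 1 / 2 < s) (u : Sobolev s) :
    Continuous (dfun j u) := continuous_fseries (summable_dcoef hj u)

end Sobolev

/-- The series converges uniformly to a continuous G, which has the same class in L² as g; the null
set is then carried from Haar measure on the circle to Lebesgue measure on (-π, π]. -/
theorem ae_eq_fseries (g : L2Torus) (hg : Summable fun k => ‖fourierCoeff (g : Torus → ℂ) k‖) :
    ∀ᵐ x : ℝ ∂(volume.restrict (Ioc (-Real.pi) Real.pi)),
      g (x : Torus) = fseries (fun k => fourierCoeff (g : Torus → ℂ) k) x := by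
  have hG : Summable fun k => fourierCoeff (g : Torus → ℂ) k • (fourier k : C(Torus, ℂ)) :=
    Summable.of_norm (by simpa only [norm_smul, fourier_norm, mul_one] using hg)
  set G := ∑' k, fourierCoeff (g : Torus → ℂ) k • (fourier k : C(Torus, ℂ)) with hGd
  have h1 : ContinuousMap.toLp (E := ℂ) 2 AddCircle.haarAddCircle ℂ G = g := by
    refine HasSum.unique ?_ (hasSum_fourier_series_L2 g)
    simpa using hG.hasSum.mapL (ContinuousMap.toLp (E := ℂ) 2 AddCircle.haarAddCircle ℂ)
  have h2 : (g : Torus → ℂ) =ᵐ[AddCircle.haarAddCircle] G := by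
    conv_lhs => rw [← h1]
    exact ContinuousMap.coeFn_toLp _ _
  have h3 : (g : Torus → ℂ) =ᵐ[volume] G := by
    rw [AddCircle.volume_eq_smul_haarAddCircle]
    exact Measure.ae_smul_measure h2 _
  have h4 := (AddCircle.measurePreserving_mk (2 * Real.pi) (-Real.pi)).quasiMeasurePreserving.ae_eq h3
  rw [show -Real.pi + 2 * Real.pi = Real.pi by ring] at h4
  filter_upwards [h4] with x hx
  rw [Function.comp_apply, Function.comp_apply] at hx
  rw [hx, hGd, fseries]
  have := ((ContinuousMap.evalCLM ℂ (x : Torus)).hasSum hG.hasSum).tsum_eq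
  rw [← hGd] at this ⊢
  simp only [ContinuousMap.evalCLM_apply] at this
  rw [← this]
  congr 1; funext k
  change fourierCoeff (g : Torus → ℂ) k • (fourier k : C(Torus, ℂ)) (x : Torus) = _
  rw [fourier_coe_apply, smul_eq_mul, expi]
  congr 2
  have h2 : (Real.pi : ℂ) ≠ 0 := by exact_mod_cast Real.pi_pos.ne'
  push_cast
  field_simp

theorem integralTorus_congr_ae {E : Type*} [NormedAddCommGroup E] [NormedSpace ℝ E] {f g : ℝ → E}
    (h : ∀ᵐ x : ℝ ∂(volume.restrict (Ioc (-Real.pi) Real.pi)), f x = g x) :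
    integralTorus f = integralTorus g := by
  rw [integralTorus, integralTorus, intervalIntegral.integral_congr_ae_restrict]
  rwa [uIoc_of_le (by linarith [Real.pi_pos])]

namespace Sobolev

variable {s : ℝ}

theorem val_ae_eq (hs : 1 / 2 < s) (u : Sobolev s) :
    ∀ᵐ x : ℝ ∂(volume.restrict (Ioc (-Real.pi) Real.pi)), u.val x = dfun 0 u x := by
  have h := summable_dcoef (j := 0) (by simpa using hs) u
  simp only [pow_zero, one_mul] at h
  filter_upwards [ae_eq_fseries (toL2 u) h] with x hx
  rw [val, hx, dfun]
  simp only [pow_zero, one_mul]; rfl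

theorem dxVal_ae_eq (hs : 3 / 2 < s) (u : Sobolev s) :
    ∀ᵐ x : ℝ ∂(volume.restrict (Ioc (-Real.pi) Real.pi)), u.dxVal x = dfun 1 u x := by
  have h := summable_dcoef (j := 1) (by norm_num; linarith) u
  simp only [pow_one] at h
  have e := fourierCoeff_dx (by linarith : 1 ≤ s) u
  filter_upwards [ae_eq_fseries (L2Torus.dx (toL2 u)) (by simpa only [e, coef] using h)] with x hx
  rw [dxVal, hx, dfun]
  simp only [pow_one, e]; rfl

/-- The nonlinearity as a continuous function. -/
def nonlinFun (F : MvPolynomial (Fin 4) ℂ) (u : Sobolev s) (x : ℝ) : ℂ :=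
  evalPoly F (dfun 0 u x) (dfun 1 u x)

theorem continuous_nonlinFun_uncurry (hs : 3 / 2 < s) (F : MvPolynomial (Fin 4) ℂ) :
    Continuous fun p : Sobolev s × ℝ => nonlinFun F p.1 p.2 :=
by
  have h0 := continuous_dfun_uncurry (s := s) (j := 0) (by norm_num; linarith)
  have h1 := continuous_dfun_uncurry (s := s) (j := 1) (by norm_num; linarith)
  have := (continuous_evalPoly F).comp (h0.prodMk h1)
  exact this

theorem continuous_nonlinFun (hs : 3 / 2 < s) (F : MvPolynomial (Fin 4) ℂ) (u : Sobolev s) :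
    Continuous (nonlinFun F u) :=
by
  have := (continuous_evalPoly F).comp ((continuous_dfun (j := 0) (by norm_num; linarith) u).prodMk
    (continuous_dfun (j := 1) (by norm_num; linarith) u))
  exact this

theorem nonlin_ae_eq (hs : 3 / 2 < s) (F : MvPolynomial (Fin 4) ℂ) (u : Sobolev s) :
    ∀ᵐ x : ℝ ∂(volume.restrict (Ioc (-Real.pi) Real.pi)), nonlin F u x = nonlinFun F u x := by
  filter_upwards [val_ae_eq (by linarith) u, dxVal_ae_eq hs u] with x h0 h1
  rw [nonlin, nonlinFun, h0, h1]

theorem integralTorus_nonlinBeta_im (hs : 3 / 2 < s) (F : MvPolynomial (Fin 4) ℂ) (u : Sobolev s) :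
    integralTorus (fun x => (nonlinBeta F u x).im)
      = (integralTorus (nonlinFun (MvPolynomial.pderiv 1 F) u)).im := by
  rw [← integralTorus_im (continuous_nonlinFun hs _ u)]
  apply integralTorus_congr_ae
  filter_upwards [val_ae_eq (by linarith) u, dxVal_ae_eq hs u] with x h0 h1
  rw [nonlinBeta, evalPolyBeta_eq, nonlinFun, h0, h1]

theorem continuous_integralTorus {X : Type*} [TopologicalSpace X] {f : X → ℝ → ℂ}
    (hf : Continuous fun p : X × ℝ => f p.1 p.2) : Continuous fun a => integralTorus (f a) :=
  (intervalIntegral.continuous_parametric_intervalIntegral_of_continuous' (μ := volume)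
    (f := f) hf (-Real.pi) Real.pi).const_smul _

theorem isometry_toSeq : Isometry (toSeq : Sobolev s → lp (fun _ : ℤ => ℂ) 2) :=
  AddMonoidHomClass.isometry_of_norm _ norm_toSeq

/-- With `isometry_toSeq` this identifies H^s with ℓ², whose completeness is what the Baire argument
needs. -/
theorem toSeq_surjective (hs : 0 ≤ s) :
    Function.Surjective (toSeq : Sobolev s → lp (fun _ : ℤ => ℂ) 2) := by
  intro d
  have hc : Memℓp (fun k : ℤ => ((bracket k ^ (-s) : ℝ) : ℂ) * d k) 2 := by
    refine (lp.memℓp d).mono' fun k => ?_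
    rw [norm_mul, Complex.norm_real, Real.norm_of_nonneg (bracket_rpow_pos k _).le]
    refine mul_le_of_le_one_left (norm_nonneg _) ?_
    simpa using bracket_rpow_le_rpow k (by linarith : -s ≤ 0)
  have e : weightedCoeff s (fourierBasis.repr.symm ⟨_, hc⟩) = d := by
    funext k
    rw [weightedCoeff, fourierCoeff_eq_repr, LinearIsometryEquiv.apply_symm_apply]
    change _ * (_ * d k) = d k
    rw [← mul_assoc, ← Complex.ofReal_mul, ← Real.rpow_add (bracket_pos k)]
    simp
  refine ⟨(⟨fourierBasis.repr.symm ⟨_, hc⟩, ?_⟩ : sobolevSubmodule s), ?_⟩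
  · change Memℓp _ 2
    rw [e]; exact lp.memℓp d
  · exact lp.ext e

theorem completeSpace (hs : 0 ≤ s) : CompleteSpace (Sobolev s) :=
  (isometry_toSeq.isUniformInducing.completeSpace_congr (toSeq_surjective hs)).2 inferInstance

theorem weightedCoeff_single (s : ℝ) (n : ℤ) (a : ℂ) :
    weightedCoeff s (fourierBasis.repr.symm (lp.single 2 n a))
      = lp.single (E := fun _ : ℤ => ℂ) 2 n (((bracket n ^ s : ℝ) : ℂ) * a) := by
  funext k
  rw [weightedCoeff, fourierCoeff_eq_repr, LinearIsometryEquiv.apply_symm_apply,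
    lp.single_apply, lp.single_apply]
  by_cases h : k = n
  · subst h; simp
  · simp [h]

/-- The element of `H^s` with Fourier coefficients `a` at `n` and `0` elsewhere. -/
def mode (s : ℝ) (n : ℤ) (a : ℂ) : Sobolev s :=
  ⟨fourierBasis.repr.symm (lp.single 2 n a), by
    change Memℓp _ 2
    rw [weightedCoeff_single]; exact lp.memℓp _⟩

theorem coef_mode (n : ℤ) (a : ℂ) (k : ℤ) : coef (mode s n a) k = if k = n then a else 0 := by
  rw [coef_eq_repr]
  change fourierBasis.repr (fourierBasis.repr.symm (lp.single 2 n a)) k = _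
  rw [LinearIsometryEquiv.apply_symm_apply, lp.single_apply]
  by_cases h : k = n
  · subst h; simp
  · simp [h]

/-- Transported from ℓ² by the isometry; it yields the density of trigonometric polynomials. -/
theorem hasSum_mode (u : Sobolev s) : HasSum (fun k => mode s k (coef u k)) u := by
  rw [← isometry_toSeq.isEmbedding.isInducing.hasSum_iff (g := toSeq)]
  convert lp.hasSum_single (p := 2) (by norm_num) (toSeq u) using 1
  funext k
  exact lp.ext (weightedCoeff_single s k _)

theorem smoothPeriodic_dfun {u : Sobolev s} (h : (Function.support (coef u)).Finite) (j : ℕ) :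
    SmoothPeriodic (dfun j u) := by
  have e : dfun j u = fun x => ∑ k ∈ h.toFinset, (I * k) ^ j * coef u k * expi k x := by
    funext x
    refine tsum_eq_sum fun k hk => ?_
    have : coef u k = 0 := by simpa using hk
    simp [this]
  rw [e]
  induction h.toFinset using Finset.induction_on with
  | empty => simpa using SmoothPeriodic.const 0
  | insert k S hk ih =>
    simp only [Finset.sum_insert hk]
    exact ((SmoothPeriodic.expi k).const_mul _).add ih

end Sobolev

end

/-! ### From weak solutions to differential equations in time -/

section

/-- Every η in C_c^∞(0, T) is the derivative of an admissible θ, namely its primitive vanishing near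
T. Since θ(0) is unrestricted, the datum p₀ enters. Integrating by parts against the candidate P
gives ∫ η(p - P) = 0, hence p = P almost everywhere, then everywhere by continuity. -/
theorem eq_add_integral_of_weak {p q : ℝ → ℂ} (hp : Continuous p) (hq : Continuous q) (p₀ : ℂ)
    {T : ℝ} (hT : 0 < T)
    (h : ∀ θ : ℝ → ℝ, ContDiff ℝ ∞ θ → (∃ T' < T, ∀ t, T' ≤ t → θ t = 0) →
      (∫ t in (0 : ℝ)..T, ((deriv θ t : ℝ) : ℂ) * p t) + (θ 0 : ℂ) * p₀
        + (∫ t in (0 : ℝ)..T, (θ t : ℂ) * q t) = 0) :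
    ∀ t ∈ Icc 0 T, p t = p₀ + ∫ τ in (0 : ℝ)..t, q τ := by
  set P : ℝ → ℂ := fun t => p₀ + ∫ τ in (0 : ℝ)..t, q τ with hP
  have hPd : ∀ t, HasDerivAt P (q t) t := fun t =>
    (intervalIntegral.integral_hasDerivAt_right (hq.intervalIntegrable _ _)
      hq.aestronglyMeasurable.stronglyMeasurableAtFilter hq.continuousAt).const_add p₀
  have hPc : Continuous P := continuous_iff_continuousAt.2 fun t => (hPd t).continuousAt
  have hr : Continuous fun t => p t - P t := hp.sub hPc
  have key : ∀ η : ℝ → ℝ, ContDiff ℝ ∞ η → HasCompactSupport η → tsupport η ⊆ Ioo 0 T →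
      ∫ t, η t • (p t - P t) = 0 := by
    intro η hη hc hsupp
    have hηc := hη.continuous
    obtain ⟨T', hT', hT'0⟩ : ∃ T' < T, ∀ t, T' ≤ t → η t = 0 := by
      rcases (tsupport η).eq_empty_or_nonempty with he | hne
      · exact ⟨0, hT, fun t _ => image_eq_zero_of_notMem_tsupport (by simp [he])⟩
      · obtain ⟨m, hm, hmax⟩ := hc.isCompact.exists_isGreatest hne
        -- The cutoff must lie strictly between the last point m of the support and T.
        refine ⟨(m + T) / 2, by linarith [(hsupp hm).2], fun t ht => ?_⟩
        refine image_eq_zero_of_notMem_tsupport fun hmem => ?_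
        have := hmax hmem
        linarith [(hsupp hm).2]
    -- The primitive is based at T, so that it vanishes from T' on.
    set θ : ℝ → ℝ := fun t => ∫ τ in T..t, η τ with hθ
    have hθd : ∀ t, HasDerivAt θ (η t) t := fun t =>
      intervalIntegral.integral_hasDerivAt_right (hηc.intervalIntegrable _ _)
        hηc.aestronglyMeasurable.stronglyMeasurableAtFilter hηc.continuousAt
    have hθ' : deriv θ = η := funext fun t => (hθd t).deriv
    have hθs : ContDiff ℝ ∞ θ :=
      contDiff_infty_iff_deriv.2 ⟨fun t => (hθd t).differentiableAt, hθ' ▸ hη⟩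
    have hθ0 : ∀ t, T' ≤ t → θ t = 0 := fun t ht => by
      refine intervalIntegral.integral_zero_ae (Filter.Eventually.of_forall fun τ hτ => hT'0 τ ?_)
      rcases mem_uIoc.1 hτ with h1 | h1 <;> linarith [h1.1]
    have h1 := h θ hθs ⟨T', hT', hθ0⟩
    have h2 := intervalIntegral.integral_mul_deriv_eq_deriv_mul (a := 0) (b := T)
      (u := fun t => (θ t : ℂ)) (u' := fun t => (η t : ℂ)) (fun t _ => (hθd t).ofReal_comp)
      (fun t _ => hPd t) ((Complex.continuous_ofReal.comp hηc).intervalIntegrable _ _)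
      (hq.intervalIntegrable _ _)
    have hP0 : P 0 = p₀ := by simp [hP]
    rw [hθ0 T hT'.le, hP0] at h2
    rw [hθ'] at h1
    have h3 : ∫ t in (0 : ℝ)..T, (η t : ℂ) * (p t - P t) = 0 := by
      have hηC : Continuous fun t => (η t : ℂ) := Complex.continuous_ofReal.comp hηc
      have i1 : Continuous fun t => (η t : ℂ) * p t := hηC.mul hp
      have i2 : Continuous fun t => (η t : ℂ) * P t := hηC.mul hPc
      simp_rw [mul_sub]
      rw [intervalIntegral.integral_sub (i1.intervalIntegrable _ _) (i2.intervalIntegrable _ _)]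
      push_cast at h2
      linear_combination h1 - h2
    rw [intervalIntegral.integral_of_le hT.le, setIntegral_eq_integral_of_forall_compl_eq_zero] at h3
    · simpa using h3
    · intro t ht
      have : η t = 0 := image_eq_zero_of_notMem_tsupport fun hm =>
        ht (Ioo_subset_Ioc_self (hsupp hm))
      simp [this]
  have hae := isOpen_Ioo.ae_eq_zero_of_integral_contDiff_smul_eq_zero (μ := volume)
    (hr.locallyIntegrable.locallyIntegrableOn (Ioo 0 T)) key
  have hopen : IsOpen (Ioo 0 T ∩ {t | p t - P t ≠ 0}) :=
    isOpen_Ioo.inter (isOpen_ne_fun hr continuous_const)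
  have hemp : Ioo 0 T ∩ {t | p t - P t ≠ 0} = ∅ := by
    refine hopen.eq_empty_of_measure_zero (μ := volume) ?_
    rw [measure_eq_zero_iff_ae_notMem]
    filter_upwards [hae] with t ht hmem
    exact hmem.2 (ht hmem.1)
  have hIoo : EqOn p P (Ioo 0 T) := fun t ht => by
    by_contra hne
    exact (eq_empty_iff_forall_notMem.1 hemp) t ⟨ht, sub_ne_zero.2 hne⟩
  -- Passing to the closure adds both end points, in particular p(0) = p₀.
  have := hIoo.closure hp hPc
  rw [closure_Ioo hT.ne] at this
  exact this

open Sobolev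

variable {s : ℝ}

/-- `y` solves `∂ₜ y = ε (- i ∂ₓ² y + F(y, ∂ₓ y, conj y, conj (∂ₓ y)))` on `[0, τ]`, with
`y(0) = φ`, when tested against smooth functions of `x`. -/
def IsEvolution (F : MvPolynomial (Fin 4) ℂ) (ε τ : ℝ) (φ : Sobolev s) (y : ℝ → Sobolev s) : Prop :=
  ∀ χ : ℝ → ℂ, SmoothPeriodic χ →
    integralTorus (fun x => dfun 0 (y 0) x * χ x) = integralTorus (fun x => dfun 0 φ x * χ x) ∧
    ∀ t ∈ Icc 0 τ, HasDerivWithinAt (fun t => integralTorus (fun x => dfun 0 (y t) x * χ x))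
      (ε * (-I * integralTorus (fun x => dfun 0 (y t) x * deriv (deriv χ) x)
        + integralTorus (fun x => nonlinFun F (y t) x * χ x))) (Icc 0 τ) t

theorem IsEvolution.mono {F : MvPolynomial (Fin 4) ℂ} {ε τ τ' : ℝ} {φ : Sobolev s}
    {y : ℝ → Sobolev s} (h : IsEvolution F ε τ φ y) (hτ : τ' ≤ τ) : IsEvolution F ε τ' φ y :=
  fun χ hχ => ⟨(h χ hχ).1, fun t ht =>
    ((h χ hχ).2 t ⟨ht.1, ht.2.trans hτ⟩).mono (Icc_subset_Icc_right hτ)⟩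

theorem isEvolution_of_weak (hs : 3 / 2 < s) {F : MvPolynomial (Fin 4) ℂ} {ε T : ℝ} (hT : 0 < T)
    {φ : Sobolev s} {y : ℝ → Sobolev s} (hy : Continuous y)
    (h : ∀ (χ : ℝ → ℂ) (θ : ℝ → ℝ), SmoothPeriodic χ → ContDiff ℝ ∞ θ →
      (∃ T' < T, ∀ t, T' ≤ t → θ t = 0) →
      (∫ t in (0 : ℝ)..T, ((deriv θ t : ℝ) : ℂ) * integralTorus (fun x => dfun 0 (y t) x * χ x))
        + (θ 0 : ℂ) * integralTorus (fun x => dfun 0 φ x * χ x)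
        + ε * (-I * (∫ t in (0 : ℝ)..T, (θ t : ℂ) *
              integralTorus (fun x => dfun 0 (y t) x * deriv (deriv χ) x))
            + (∫ t in (0 : ℝ)..T, (θ t : ℂ) *
              integralTorus (fun x => nonlinFun F (y t) x * χ x))) = 0) :
    IsEvolution F ε T φ y := by
  intro χ hχ
  have c0 : ∀ χ : ℝ → ℂ, Continuous χ →
      Continuous fun t => integralTorus (fun x => dfun 0 (y t) x * χ x) := fun χ hχ => by
    have := (continuous_dfun_uncurry (s := s) (j := 0) (by norm_num; linarith)).comp
      ((hy.comp continuous_fst).prodMk (continuous_snd (X := ℝ) (Y := ℝ)))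
    exact continuous_integralTorus (this.mul (hχ.comp continuous_snd))
  have c1 : Continuous fun t => integralTorus (fun x => nonlinFun F (y t) x * χ x) := by
    have := (continuous_nonlinFun_uncurry hs F).comp
      ((hy.comp continuous_fst).prodMk (continuous_snd (X := ℝ) (Y := ℝ)))
    exact continuous_integralTorus (this.mul (hχ.continuous.comp continuous_snd))
  have c2 := c0 _ hχ.deriv.deriv.continuous
  have hq : Continuous fun t =>
      (ε : ℂ) * (-I * integralTorus (fun x => dfun 0 (y t) x * deriv (deriv χ) x)
        + integralTorus (fun x => nonlinFun F (y t) x * χ x)) :=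
    continuous_const.mul ((continuous_const.mul c2).add c1)
  have key := eq_add_integral_of_weak (c0 χ hχ.continuous) hq
    (integralTorus (fun x => dfun 0 φ x * χ x)) hT (fun θ hθ hθ' => by
      have hθc : Continuous fun t => (θ t : ℂ) := Complex.continuous_ofReal.comp hθ.continuous
      rw [← h χ θ hχ hθ hθ']
      congr 1
      rw [← intervalIntegral.integral_const_mul, ← intervalIntegral.integral_add,
        ← intervalIntegral.integral_const_mul]
      · congr 1; funext t; ring
      · exact (continuous_const.mul (hθc.mul c2)).intervalIntegrable _ _
      · exact (hθc.mul c1).intervalIntegrable _ _)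
  refine ⟨by simpa using key 0 ⟨le_rfl, hT.le⟩, fun t ht => ?_⟩
  have hd := (intervalIntegral.integral_hasDerivAt_right (hq.intervalIntegrable 0 t)
      hq.aestronglyMeasurable.stronglyMeasurableAtFilter hq.continuousAt).const_add
      (integralTorus (fun x => dfun 0 φ x * χ x))
  exact hd.hasDerivWithinAt.congr key (key t ht)

theorem integralTorus_val_mul (hs : 1 / 2 < s) (u : Sobolev s) (c : ℂ) (χ : ℝ → ℂ) :
    integralTorus (fun x => u.val x * (c * χ x)) = c * integralTorus (fun x => dfun 0 u x * χ x) := by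
  rw [← integralTorus_const_mul]
  apply integralTorus_congr_ae
  filter_upwards [val_ae_eq hs u] with x hx
  rw [hx]; ring

theorem integralTorus_nonlin_mul (hs : 3 / 2 < s) (F : MvPolynomial (Fin 4) ℂ) (u : Sobolev s)
    (c : ℂ) (χ : ℝ → ℂ) :
    integralTorus (fun x => nonlin F u x * (c * χ x))
      = c * integralTorus (fun x => nonlinFun F u x * χ x) := by
  rw [← integralTorus_const_mul]
  apply integralTorus_congr_ae
  filter_upwards [nonlin_ae_eq hs F u] with x hx
  rw [hx]; ring

theorem isSmoothPeriodic_mul {θ : ℝ → ℝ} {χ : ℝ → ℂ} (hθ : ContDiff ℝ ∞ θ)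
    (hχ : SmoothPeriodic χ) : IsSmoothPeriodic fun t x => (θ t : ℂ) * χ x where
  smooth := (Complex.ofRealCLM.contDiff.comp (hθ.comp contDiff_fst)).mul
    (hχ.contDiff.comp contDiff_snd)
  periodic t x := by simp only [hχ.periodic x]

theorem iteratedDeriv_two_const_mul {χ : ℝ → ℂ} (hχ : SmoothPeriodic χ) (c : ℂ) (x : ℝ) :
    iteratedDeriv 2 (fun x => c * χ x) x = c * deriv (deriv χ) x := by
  rw [iteratedDeriv_succ, iteratedDeriv_one]
  have : deriv (fun x => c * χ x) = fun x => c * deriv χ x :=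
    funext fun x => ((hχ.hasDerivAt x).const_mul c).deriv
  rw [this]
  exact ((hχ.deriv.hasDerivAt x).const_mul c).deriv

theorem exists_isEvolution_of_forward (hs : 3 / 2 < s) {F : MvPolynomial (Fin 4) ℂ} {T : ℝ}
    (hT : 0 < T) {φ : Sobolev s} {u : ℝ → Sobolev s} (hu : ContinuousOn u (Icc 0 T))
    (h : IsSolutionForward F s T φ u) :
    ∃ y : ℝ → Sobolev s, Continuous y ∧ (∃ M : ℝ, ∀ t, ‖y t‖ ≤ M) ∧ IsEvolution F 1 T φ y := by
  -- Clamping time to [0, T] makes the curve continuous and bounded on all of ℝ without changing it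
  -- on [0, T].
  have hy : Continuous fun t => u (projIcc 0 T hT.le t) :=
    hu.comp_continuous (continuous_subtype_val.comp continuous_projIcc) fun t => Subtype.prop _
  have hyu : ∀ t ∈ Icc 0 T, u (projIcc 0 T hT.le t) = u t := fun t ht => by
    rw [projIcc_of_mem hT.le ht]
  refine ⟨_, hy, ?_, isEvolution_of_weak hs hT hy fun χ θ hχ hθ hθ0 => ?_⟩
  · obtain ⟨M, hM⟩ := isCompact_Icc.exists_bound_of_continuousOn hu
    exact ⟨M, fun t => hM _ (Subtype.prop _)⟩
  have hw := h.weak (fun t x => (θ t : ℂ) * χ x) ⟨isSmoothPeriodic_mul hθ hχ, by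
    obtain ⟨T', h1, h2⟩ := hθ0
    exact ⟨T', h1, fun t ht x => by simp [h2 t ht]⟩⟩
  have hd : ∀ x t, deriv (fun τ => (θ τ : ℂ) * χ x) t = ((deriv θ t : ℝ) : ℂ) * χ x := fun x t =>
    (((hθ.differentiable (by simp) t).hasDerivAt.ofReal_comp).mul_const _).deriv
  simp only [hd, iteratedDeriv_two_const_mul hχ, integralTorus_val_mul (by linarith : 1 / 2 < s),
    integralTorus_nonlin_mul hs] at hw
  have hcongr : ∀ f : ℝ → Sobolev s → ℂ,
      ∫ t in (0 : ℝ)..T, f t (u (projIcc 0 T hT.le t)) = ∫ t in (0 : ℝ)..T, f t (u t) := fun f => by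
    refine intervalIntegral.integral_congr fun t ht => ?_
    rw [uIcc_of_le hT.le] at ht
    simp only [hyu t ht]
  rw [hcongr fun t v => ((deriv θ t : ℝ) : ℂ) * integralTorus fun x => dfun 0 v x * χ x,
    hcongr fun t v => (θ t : ℂ) * integralTorus fun x => dfun 0 v x * deriv (deriv χ) x,
    hcongr fun t v => (θ t : ℂ) * integralTorus fun x => nonlinFun F v x * χ x]
  push_cast
  linear_combination -hw

/-- Time reversal y(t) = u(-t) turns the backward problem into a forward one with ε = -1. -/
theorem exists_isEvolution_of_backward (hs : 3 / 2 < s) {F : MvPolynomial (Fin 4) ℂ} {T : ℝ}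
    (hT : 0 < T) {φ : Sobolev s} {u : ℝ → Sobolev s} (hu : ContinuousOn u (Icc (-T) 0))
    (h : IsSolutionBackward F s T φ u) :
    ∃ y : ℝ → Sobolev s, Continuous y ∧ (∃ M : ℝ, ∀ t, ‖y t‖ ≤ M) ∧ IsEvolution F (-1) T φ y := by
  have hmem : ∀ t, -(projIcc 0 T hT.le t : ℝ) ∈ Icc (-T) 0 := fun t =>
    ⟨neg_le_neg (projIcc 0 T hT.le t).2.2, neg_nonpos.2 (projIcc 0 T hT.le t).2.1⟩
  have hy : Continuous fun t => u (-projIcc 0 T hT.le t) :=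
    hu.comp_continuous (continuous_subtype_val.comp continuous_projIcc).neg hmem
  have hyu : ∀ t ∈ Icc 0 T, u (-projIcc 0 T hT.le t) = u (-t) := fun t ht => by
    rw [projIcc_of_mem hT.le ht]
  refine ⟨_, hy, ?_, isEvolution_of_weak hs hT hy fun χ θ hχ hθ hθ0 => ?_⟩
  · obtain ⟨M, hM⟩ := isCompact_Icc.exists_bound_of_continuousOn hu
    exact ⟨M, fun t => hM _ (hmem t)⟩
  have hw := h.weak (fun t x => (θ (-t) : ℂ) * χ x)
    ⟨isSmoothPeriodic_mul (hθ.comp contDiff_neg) hχ, by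
      obtain ⟨T', h1, h2⟩ := hθ0
      exact ⟨T', h1, fun t ht x => by simp [h2 (-t) (by linarith)]⟩⟩
  have hd : ∀ x t, deriv (fun τ => (θ (-τ) : ℂ) * χ x) t = ((-deriv θ (-t) : ℝ) : ℂ) * χ x := by
    intro x t
    have h1 := ((hθ.differentiable (by simp) (-t)).hasDerivAt.comp t (hasDerivAt_neg t))
    have h2 := (h1.ofReal_comp.mul_const (χ x)).deriv
    simpa using h2
  simp only [hd, iteratedDeriv_two_const_mul hχ, integralTorus_val_mul (by linarith : 1 / 2 < s),
    integralTorus_nonlin_mul hs] at hw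
  have hcongr : ∀ f : ℝ → Sobolev s → ℂ,
      ∫ t in (0 : ℝ)..T, f t (u (-projIcc 0 T hT.le t)) = ∫ t in (-T)..(0 : ℝ), f (-t) (u t) := by
    intro f
    have := intervalIntegral.integral_comp_neg (a := 0) (b := T) (fun t => f (-t) (u t))
    rw [neg_zero] at this
    rw [← this]
    refine intervalIntegral.integral_congr fun t ht => ?_
    rw [uIcc_of_le hT.le] at ht
    simp only [hyu t ht, neg_neg]
  rw [hcongr fun t v => ((deriv θ t : ℝ) : ℂ) * integralTorus fun x => dfun 0 v x * χ x,
    hcongr fun t v => (θ t : ℂ) * integralTorus fun x => dfun 0 v x * deriv (deriv χ) x,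
    hcongr fun t v => (θ t : ℂ) * integralTorus fun x => nonlinFun F v x * χ x]
  simp only [Complex.ofReal_neg, neg_mul, intervalIntegral.integral_neg, neg_zero] at hw
  push_cast
  linear_combination hw

end

/-! ### The equation for `∂ₓ u`, and uniform decay of families -/

section

open Sobolev

variable {s : ℝ}

/-- The `x`-derivative of the nonlinearity. -/
def nonlinDeriv (F : MvPolynomial (Fin 4) ℂ) (u : Sobolev s) (x : ℝ) : ℂ :=
  nonlinFun (MvPolynomial.pderiv 0 F) u x * dfun 1 u x
    + nonlinFun (MvPolynomial.pderiv 1 F) u x * dfun 2 u x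
    + nonlinFun (MvPolynomial.pderiv 2 F) u x * conj (dfun 1 u x)
    + nonlinFun (MvPolynomial.pderiv 3 F) u x * conj (dfun 2 u x)

theorem hasDerivAt_nonlinFun (hs : 5 / 2 < s) (F : MvPolynomial (Fin 4) ℂ) (u : Sobolev s) (x : ℝ) :
    HasDerivAt (nonlinFun F u) (nonlinDeriv F u x) x :=
  hasDerivAt_evalPoly F (hasDerivAt_dfun (j := 0) (by norm_num; linarith) u x)
    (hasDerivAt_dfun (j := 1) (by norm_num; linarith) u x)

theorem continuous_nonlinDeriv (hs : 5 / 2 < s) (F : MvPolynomial (Fin 4) ℂ) (u : Sobolev s) :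
    Continuous (nonlinDeriv F u) := by
  have h0 := fun i => continuous_nonlinFun (by linarith) (MvPolynomial.pderiv i F) u
  have h1 := continuous_dfun (j := 1) (by norm_num; linarith) u
  have h2 := continuous_dfun (j := 2) (by norm_num; linarith) u
  have c := Complex.continuous_conj
  exact ((((h0 0).mul h1).add ((h0 1).mul h2)).add ((h0 2).mul (c.comp h1))).add
    ((h0 3).mul (c.comp h2))

theorem periodic_nonlinFun (F : MvPolynomial (Fin 4) ℂ) (u : Sobolev s) :
    Function.Periodic (nonlinFun F u) (2 * Real.pi) := fun x => by
  simp only [nonlinFun, periodic_dfun _ u x]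

theorem integralTorus_dfun_one_mul (hs : 5 / 2 < s) (u : Sobolev s) {η : ℝ → ℂ}
    (hη : SmoothPeriodic η) :
    integralTorus (fun x => dfun 1 u x * η x) = integralTorus (fun x => dfun 0 u x * (-deriv η x)) := by
  rw [integralTorus_deriv_mul (hasDerivAt_dfun (j := 0) (by norm_num; linarith) u) hη.hasDerivAt
    (continuous_dfun (j := 1) (by norm_num; linarith) u) hη.deriv.continuous (periodic_dfun 0 u)
    hη.periodic, ← integralTorus_neg]
  simp only [mul_neg]

namespace IsEvolution

variable {F : MvPolynomial (Fin 4) ℂ} {ε τ : ℝ} {φ : Sobolev s} {y : ℝ → Sobolev s} {η : ℝ → ℂ}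

theorem integral_dfun_one_zero (hs : 5 / 2 < s) (h : IsEvolution F ε τ φ y)
    (hη : SmoothPeriodic η) :
    integralTorus (fun x => dfun 1 (y 0) x * η x) = integralTorus (fun x => dfun 1 φ x * η x) := by
  rw [integralTorus_dfun_one_mul hs _ hη, integralTorus_dfun_one_mul hs _ hη]
  exact (h _ hη.deriv.neg).1

/-- The equation for u is tested with -η' and integrated by parts, so that no regularity beyond H^s
is asked of the solution. -/
theorem hasDerivWithinAt_dfun_one (hs : 5 / 2 < s) (h : IsEvolution F ε τ φ y)
    (hη : SmoothPeriodic η) {t : ℝ} (ht : t ∈ Icc 0 τ) :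
    HasDerivWithinAt (fun t => integralTorus (fun x => dfun 1 (y t) x * η x))
      (ε * (-I * integralTorus (fun x => dfun 1 (y t) x * deriv (deriv η) x)
        + integralTorus (fun x => nonlinDeriv F (y t) x * η x))) (Icc 0 τ) t := by
  have h1 := (h _ hη.deriv.neg).2 t ht
  simp only [← integralTorus_dfun_one_mul hs _ hη] at h1
  have e : deriv (deriv fun x => -deriv η x) = fun x => - deriv (deriv (deriv η)) x := by
    have : deriv (fun x => -deriv η x) = fun x => - deriv (deriv η) x := funext fun x => deriv.fun_neg
    rw [this]; exact funext fun x => deriv.fun_neg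
  have e2 := integralTorus_deriv_mul (hasDerivAt_nonlinFun hs F (y t)) hη.hasDerivAt
    (continuous_nonlinDeriv hs F (y t)) hη.deriv.continuous (periodic_nonlinFun F _) hη.periodic
  rw [e, ← integralTorus_dfun_one_mul hs _ hη.deriv.deriv] at h1
  rw [e2, ← integralTorus_neg]
  simpa only [mul_neg] using h1

/-- Conjugation of the previous identity at conj η. The dispersive term changes sign since ε is
real; this makes the conjugate term nonresonant. -/
theorem hasDerivWithinAt_conj_dfun_one (hs : 5 / 2 < s) (h : IsEvolution F ε τ φ y)
    (hη : SmoothPeriodic η) {t : ℝ} (ht : t ∈ Icc 0 τ) :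
    HasDerivWithinAt (fun t => integralTorus (fun x => conj (dfun 1 (y t) x) * η x))
      (ε * (I * integralTorus (fun x => conj (dfun 1 (y t) x) * deriv (deriv η) x)
        + integralTorus (fun x => conj (nonlinDeriv F (y t) x) * η x))) (Icc 0 τ) t := by
  have h1 := Complex.conjCLE.toContinuousLinearMap.hasFDerivAt.comp_hasDerivWithinAt t
    (h.hasDerivWithinAt_dfun_one hs hη.conj_apply ht)
  have ed : ∀ {η : ℝ → ℂ}, SmoothPeriodic η →
      deriv (fun x => conj (η x)) = fun x => conj (deriv η x) := fun hη => funext fun x =>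
    (Complex.conjCLE.toContinuousLinearMap.hasFDerivAt.comp_hasDerivAt x (hη.hasDerivAt x)).deriv
  rw [ed hη, ed hη.deriv] at h1
  have e : ∀ f g : ℝ → ℂ, conj (integralTorus fun x => f x * conj (g x))
      = integralTorus fun x => conj (f x) * g x := fun f g => by
    rw [← integralTorus_conj]; simp
  have h2 : (fun t => integralTorus (fun x => conj (dfun 1 (y t) x) * η x))
      = fun t => conj (integralTorus fun x => dfun 1 (y t) x * conj (η x)) := by
    simp only [e]
  rw [h2]
  refine HasDerivWithinAt.congr_deriv h1 ?_
  change conj (_ : ℂ) = _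
  rw [map_mul, map_add, map_mul, e, e]
  simp

end IsEvolution

/-- The functions `f i`, for indices `i` with `P i`, have decay of order `σ` with constants
`O(w i)`. -/
def FamilyDecay {ι : Type*} (P : ι → Prop) (σ : ℝ) (w : ι → ℝ) (f : ι → ℝ → ℂ) : Prop :=
  ∃ C : ℝ, 0 ≤ C ∧ ∀ i, P i → 0 ≤ w i ∧ HasDecay σ (C * w i) (f i)

namespace FamilyDecay

variable {ι : Type*} {P : ι → Prop} {σ p q : ℝ} {w w' : ι → ℝ} {f g : ι → ℝ → ℂ}

theorem add (hf : FamilyDecay P σ w f) (hg : FamilyDecay P σ w g) :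
    FamilyDecay P σ w (fun i x => f i x + g i x) := by
  obtain ⟨A, hA, hf⟩ := hf
  obtain ⟨B, hB, hg⟩ := hg
  refine ⟨A + B, by positivity, fun i hi => ⟨(hf i hi).1, ?_⟩⟩
  rw [add_mul]
  exact (hf i hi).2.add (hg i hi).2

theorem const_mul (hf : FamilyDecay P σ w f) (a : ℂ) : FamilyDecay P σ w (fun i x => a * f i x) := by
  obtain ⟨A, hA, hf⟩ := hf
  refine ⟨‖a‖ * A, by positivity, fun i hi => ⟨(hf i hi).1, ?_⟩⟩
  rw [mul_assoc]
  exact (hf i hi).2.const_mul a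

theorem conj_apply (hf : FamilyDecay P σ w f) : FamilyDecay P σ w (fun i x => conj (f i x)) := by
  obtain ⟨A, hA, hf⟩ := hf
  exact ⟨A, hA, fun i hi => ⟨(hf i hi).1, (hf i hi).2.conj_apply⟩⟩

theorem mul (hp : 1 < p) (hq : 0 ≤ q) (hqp : q ≤ p) (hf : FamilyDecay P p w f)
    (hg : FamilyDecay P q w' g) : FamilyDecay P q (fun i => w i * w' i) (fun i x => f i x * g i x) := by
  obtain ⟨A, hA, hf⟩ := hf
  obtain ⟨B, hB, hg⟩ := hg
  obtain ⟨K, hK, h⟩ := HasDecay.exists_mul hp hq hqp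
  refine ⟨K * (A * B), by positivity, fun i hi => ⟨mul_nonneg (hf i hi).1 (hg i hi).1, ?_⟩⟩
  convert h (hf i hi).2 (hg i hi).2 using 1
  ring

theorem mul_one (hp : 1 < p) (hq : 0 ≤ q) (hqp : q ≤ p) (hf : FamilyDecay P p (fun _ => 1) f)
    (hg : FamilyDecay P q w g) : FamilyDecay P q w (fun i x => f i x * g i x) := by
  simpa using hf.mul hp hq hqp hg

theorem mono (hf : FamilyDecay P p w f) (hqp : q ≤ p) : FamilyDecay P q w f := by
  obtain ⟨A, hA, hf⟩ := hf
  exact ⟨A, hA, fun i hi => ⟨(hf i hi).1, (hf i hi).2.mono hqp le_rfl⟩⟩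

theorem of_smooth {f : ℝ → ℂ} (hf : SmoothPeriodic f) (P : ι → Prop) (σ : ℝ) :
    FamilyDecay P σ (fun _ => 1) (fun _ => f) := by
  obtain ⟨M, hM⟩ := hf.exists_hasDecay σ
  exact ⟨M, hM.nonneg, fun i _ => ⟨zero_le_one, by simpa using hM⟩⟩

theorem continuous (hf : FamilyDecay P σ w f) {i : ι} (hi : P i) : Continuous (f i) := by
  obtain ⟨A, hA, hf⟩ := hf
  exact (hf i hi).2.continuous

theorem exists_norm_integral_le (hf : FamilyDecay P σ w f) : ∃ C : ℝ, 0 ≤ C ∧ ∀ i, P i → ∀ n,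
    ‖integralTorus (fun x => f i x * expi (-n) x)‖ ≤ C * w i * bracket n ^ (-σ) := by
  obtain ⟨A, hA, hf⟩ := hf
  exact ⟨A, hA, fun i hi n => (hf i hi).2.norm_integral_le n⟩

end FamilyDecay

theorem familyDecay_dfun {j : ℕ} (hj : (j : ℝ) + 1 / 2 < s) {ι : Type*} {P : ι → Prop}
    {u : ι → Sobolev s} {M : ℝ} (h : ∀ i, P i → ‖u i‖ ≤ M) :
    FamilyDecay P (s - j) (fun _ => 1) (fun i => dfun j (u i)) :=
  ⟨|M|, abs_nonneg M, fun i hi => ⟨zero_le_one, (hasDecay_dfun_norm hj (u i)).mono le_rfl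
    ((h i hi).trans ((le_abs_self M).trans_eq (_root_.mul_one _).symm))⟩⟩

theorem familyDecay_nonlinFun (hs : 5 / 2 < s) (F : MvPolynomial (Fin 4) ℂ) {ι : Type*}
    {P : ι → Prop} {u : ι → Sobolev s} {M : ℝ} (h : ∀ i, P i → ‖u i‖ ≤ M) :
    FamilyDecay P (s - 1) (fun _ => 1) (fun i => nonlinFun F (u i)) := by
  obtain ⟨C, hC, hF⟩ := exists_hasDecay_evalPoly F (p := s - 1) (M := M) (by linarith)
  refine ⟨C, hC, fun i hi => ⟨zero_le_one, ?_⟩⟩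
  rw [_root_.mul_one]
  refine hF ((hasDecay_dfun_norm (j := 0) (by norm_num; linarith) (u i)).mono (by norm_num) (h i hi))
    ((hasDecay_dfun_norm (j := 1) (by norm_num; linarith) (u i)).mono (by norm_num) (h i hi))

/-- The second derivatives limit the order to s - 2; the coefficients in front of them have order s
- 1 > 1, as `exists_mul` requires. -/
theorem familyDecay_nonlinDeriv (hs : 5 / 2 < s) (F : MvPolynomial (Fin 4) ℂ) {ι : Type*}
    {P : ι → Prop} {u : ι → Sobolev s} {M : ℝ} (h : ∀ i, P i → ‖u i‖ ≤ M) :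
    FamilyDecay P (s - 2) (fun _ => 1) (fun i => nonlinDeriv F (u i)) := by
  have h0 := fun j => familyDecay_nonlinFun hs (MvPolynomial.pderiv j F) h
  have h1 : FamilyDecay P (s - 2) (fun _ => 1) (fun i => dfun 1 (u i)) :=
    (familyDecay_dfun (j := 1) (by norm_num; linarith) h).mono (by norm_num; linarith)
  have h2 : FamilyDecay P (s - 2) (fun _ => 1) (fun i => dfun 2 (u i)) :=
    (familyDecay_dfun (j := 2) (by norm_num; linarith) h).mono (by norm_num)
  have hm := fun j {g} (hg : FamilyDecay P (s - 2) (fun _ => 1) g) =>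
    (h0 j).mul_one (by linarith) (by linarith) (by linarith) hg
  exact (((hm 0 h1).add (hm 1 h2)).add (hm 2 h1.conj_apply)).add (hm 3 h2.conj_apply)

end

/-! ### The gauge transformation and the conjugate term -/

section

open Sobolev

variable {s : ℝ}

/-- The function `g` solves `g' = (i/2) (a - m) g`, where `a` is the coefficient of `∂ₓ² u` in the
differentiated equation, frozen at the smooth function `φ₀`. -/
structure IsGauge (F : MvPolynomial (Fin 4) ℂ) (φ₀ : Sobolev s) (m : ℂ) (g : ℝ → ℂ) : Prop where
  smooth_zero : SmoothPeriodic (dfun 0 φ₀)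
  smooth_one : SmoothPeriodic (dfun 1 φ₀)
  smooth : SmoothPeriodic g
  deriv_eq : ∀ x, deriv g x = I / 2 * (nonlinFun (MvPolynomial.pderiv 1 F) φ₀ x - m) * g x

theorem IsGauge.smooth_nonlinFun {F : MvPolynomial (Fin 4) ℂ} {φ₀ : Sobolev s} {m : ℂ} {g : ℝ → ℂ}
    (h : IsGauge F φ₀ m g) (G : MvPolynomial (Fin 4) ℂ) : SmoothPeriodic (nonlinFun G φ₀) :=
  SmoothPeriodic.evalPoly G h.smooth_zero h.smooth_one

/-- `u` is bounded by `M` in `H^s`, and `δ`-close to `φ₀` in a weaker norm. -/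
def IsClose (φ₀ : Sobolev s) (M : ℝ) (i : Sobolev s × ℝ) : Prop :=
  ‖i.1‖ ≤ M ∧ HasDecay (s - 3 / 2) i.2 (fun x => dfun 0 i.1 x - dfun 0 φ₀ x) ∧
    HasDecay (s - 3 / 2) i.2 (fun x => dfun 1 i.1 x - dfun 1 φ₀ x)

/-- Order s - 3/2 still exceeds 1, so the Lipschitz bound for polynomials applies in the weaker
norm; this is a use of s > 5/2. -/
theorem familyDecay_nonlinFun_sub (hs : 5 / 2 < s) (F : MvPolynomial (Fin 4) ℂ) (φ₀ : Sobolev s)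
    (M : ℝ) : FamilyDecay (IsClose φ₀ M) (s - 3 / 2) (fun i => i.2)
      (fun i x => nonlinFun F i.1 x - nonlinFun F φ₀ x) := by
  obtain ⟨C, hC, hF⟩ := exists_hasDecay_evalPoly_sub F (p := s - 3 / 2) (M := max M ‖φ₀‖)
    (by linarith)
  refine ⟨C, hC, fun i hi => ⟨hi.2.1.nonneg, ?_⟩⟩
  have h0 := fun u : Sobolev s => hasDecay_dfun_norm (j := 0) (by norm_num; linarith) u
  have h1 := fun u : Sobolev s => hasDecay_dfun_norm (j := 1) (by norm_num; linarith) u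
  have e0 : s - 3 / 2 ≤ s - (0 : ℕ) := by norm_num
  have e1 : s - 3 / 2 ≤ s - (1 : ℕ) := by norm_num; linarith
  exact hF ((h0 _).mono e0 (hi.1.trans (le_max_left _ _)))
    ((h1 _).mono e1 (hi.1.trans (le_max_left _ _))) ((h0 _).mono e0 (le_max_right _ _))
    ((h1 _).mono e1 (le_max_right _ _)) hi.2.1 hi.2.2

theorem deriv_deriv_expi_mul {g : ℝ → ℂ} (hg : SmoothPeriodic g) (n : ℤ) (x : ℝ) :
    deriv (deriv fun x => g x * expi (-n) x) x
      = (-(n : ℂ) ^ 2 * g x - 2 * I * n * deriv g x + deriv (deriv g) x) * expi (-n) x := by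
  have h1 : ∀ {g : ℝ → ℂ}, SmoothPeriodic g → deriv (fun x => g x * expi (-n) x)
      = fun x => (deriv g x + -I * n * g x) * expi (-n) x := fun hg => funext fun x => by
    rw [((hg.hasDerivAt x).fun_mul (hasDerivAt_expi (-n) x)).deriv]
    push_cast; ring
  have h2 := hg.deriv.add (hg.const_mul (-I * n))
  rw [h1 hg, h1 h2]
  have h3 : deriv (fun x => deriv g x + -I * n * g x) x = deriv (deriv g) x + -I * n * deriv g x :=
    ((hg.deriv.hasDerivAt x).add ((hg.hasDerivAt x).const_mul (-I * (n : ℂ)))).deriv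
  simp only [h3]
  linear_combination (n : ℂ) ^ 2 * g x * expi (-n) x * I_sq

theorem integralTorus_ibp_expi (f f' : ℝ → ℂ) (hf : ∀ x, HasDerivAt f (f' x) x)
    (hf' : Continuous f') (pf : Function.Periodic f (2 * Real.pi)) {b : ℝ → ℂ}
    (hb : SmoothPeriodic b) (n : ℤ) :
    integralTorus (fun x => (f' x * b x + f x * (deriv b x - I * n * b x)) * expi (-n) x) = 0 := by
  have hη := hb.mul (SmoothPeriodic.expi (-n))
  have h := integralTorus_deriv_mul hf hη.hasDerivAt hf' hη.deriv.continuous pf hη.periodic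
  have hfc : Continuous f := continuous_iff_continuousAt.2 fun x => (hf x).continuousAt
  rw [← add_eq_zero_iff_eq_neg, ← integralTorus_add (by exact hf'.mul hη.continuous)
    (by exact hfc.mul hη.deriv.continuous)] at h
  rw [← h]
  congr 1; funext x
  rw [((hb.hasDerivAt x).fun_mul (hasDerivAt_expi (-n) x)).deriv]
  push_cast; ring

theorem integralTorus_lincomb {F1 F2 F3 F4 F5 F6 : ℝ → ℂ} (h1 : Continuous F1) (h2 : Continuous F2)
    (h3 : Continuous F3) (h4 : Continuous F4) (h5 : Continuous F5) (h6 : Continuous F6)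
    (h50 : integralTorus F5 = 0) (h60 : integralTorus F6 = 0) (a1 a3 a4 : ℂ) :
    integralTorus F1 * a1 + integralTorus F2 - (a3 * integralTorus F3 + a4 * integralTorus F4)
      = integralTorus fun x => (a1 * F1 x + F2 x) - (a3 * F3 x + a4 * F4 x) - (F5 x + F6 x) := by
  rw [integralTorus_sub (by fun_prop) (by fun_prop), integralTorus_sub (by fun_prop) (by fun_prop),
    integralTorus_add (by fun_prop) (by fun_prop), integralTorus_add (by fun_prop) (by fun_prop),
    integralTorus_add h5 h6, h50, h60, integralTorus_const_mul, integralTorus_const_mul,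
    integralTorus_const_mul]
  ring

/-- With v = ∂ₓu, integrating a v_x by parts against g e^{-inx} produces ina, while the dispersive
term produces in² and -2ng'. The gauge equation makes -2ng' = -in(a - m)g, so only inm survives at
order n. What remains is either free of v_x, of size ⟨n⟩^{1-s}, or carries v_x or its conjugate
times a freezing error, of size δ⟨n⟩^{2-s}. -/
theorem exists_gauge_estimate (hs : 5 / 2 < s) {F : MvPolynomial (Fin 4) ℂ} {φ₀ : Sobolev s} {m : ℂ}
    {g : ℝ → ℂ} (hg : IsGauge F φ₀ m g) (M : ℝ) : ∃ C : ℝ, 0 ≤ C ∧ ∀ i, IsClose φ₀ M i → ∀ n : ℤ,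
      ‖(-I * integralTorus (fun x => dfun 1 i.1 x * deriv (deriv fun x => g x * expi (-n) x) x)
        + integralTorus (fun x => nonlinDeriv F i.1 x * (g x * expi (-n) x)))
        - ((I * n ^ 2 + I * n * m) * integralTorus (fun x => dfun 1 i.1 x * (g x * expi (-n) x))
          + I * n * integralTorus (fun x => conj (dfun 1 i.1 x)
            * ((nonlinFun (MvPolynomial.pderiv 3 F) φ₀ x * g x) * expi (-n) x)))‖
      ≤ C * (bracket n ^ (1 - s) + i.2 * bracket n ^ (2 - s)) := by
  set a : ℝ → ℂ := nonlinFun (MvPolynomial.pderiv 1 F) φ₀ with ha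
  set b : ℝ → ℂ := nonlinFun (MvPolynomial.pderiv 3 F) φ₀ with hb
  have sa : SmoothPeriodic a := hg.smooth_nonlinFun _
  have sb : SmoothPeriodic b := hg.smooth_nonlinFun _
  have sag := sa.mul hg.smooth
  have sbg := sb.mul hg.smooth
  have hM : ∀ i, IsClose φ₀ M i → ‖i.1‖ ≤ M := fun i hi => hi.1
  have d1 : FamilyDecay (IsClose φ₀ M) (s - 1) (fun _ => 1) (fun i => dfun 1 i.1) :=
    (familyDecay_dfun (j := 1) (by norm_num; linarith) hM).mono (by norm_num)
  have d2 : FamilyDecay (IsClose φ₀ M) (s - 2) (fun _ => 1) (fun i => dfun 2 i.1) :=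
    (familyDecay_dfun (j := 2) (by norm_num; linarith) hM).mono (by norm_num)
  have fN := fun j => familyDecay_nonlinFun hs (MvPolynomial.pderiv j F) hM
  have fS := fun j => familyDecay_nonlinFun_sub hs (MvPolynomial.pderiv j F) φ₀ M
  have sm : ∀ {f : ℝ → ℂ}, SmoothPeriodic f → ∀ σ,
      FamilyDecay (IsClose φ₀ M) σ (fun _ => 1) (fun _ => f) :=
    fun hf σ => FamilyDecay.of_smooth hf _ σ
  have mul1 : ∀ {f g : Sobolev s × ℝ → ℝ → ℂ},
      FamilyDecay (IsClose φ₀ M) (s - 1) (fun _ => 1) f →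
      FamilyDecay (IsClose φ₀ M) (s - 1) (fun _ => 1) g →
      FamilyDecay (IsClose φ₀ M) (s - 1) (fun _ => 1) (fun i x => f i x * g i x) :=
    fun hf hg => hf.mul_one (by linarith) (by linarith) le_rfl hg
  -- The terms without second derivatives of u: g'' from dispersion, the derivatives of F in u and
  -- conj u, and the derivatives falling on ag and bg.
  have X1 := ((((mul1 d1 (sm hg.smooth.deriv.deriv _)).const_mul (-I)).add
    (mul1 (sm hg.smooth _) ((mul1 (fN 0) d1).add (mul1 (fN 2) d1.conj_apply)))).add
    ((mul1 d1 (sm sag.deriv _)).const_mul (-1))).add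
    ((mul1 d1.conj_apply (sm sbg.deriv _)).const_mul (-1))
  have mul2 : ∀ {j} {g : Sobolev s × ℝ → ℝ → ℂ},
      FamilyDecay (IsClose φ₀ M) (s - 2) (fun _ => 1) g →
      FamilyDecay (IsClose φ₀ M) (s - 2) (fun i => i.2) (fun i x =>
        (nonlinFun (MvPolynomial.pderiv j F) i.1 x - nonlinFun (MvPolynomial.pderiv j F) φ₀ x)
          * g i x) := fun {j g} h => by
    simpa using (fS j).mul (by linarith) (by linarith) (by linarith) h
  -- The terms with ∂ₓ²u or its conjugate, each multiplied by a difference from the frozen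
  -- coefficient.
  have X2 := (sm hg.smooth (s - 3 / 2)).mul_one (by linarith) (by linarith) (by linarith)
    ((mul2 (j := 1) d2).add (mul2 (j := 3) d2.conj_apply))
  obtain ⟨C1, hC1, h1⟩ := X1.exists_norm_integral_le
  obtain ⟨C2, hC2, h2⟩ := X2.exists_norm_integral_le
  refine ⟨C1 + C2, by positivity, fun i hi n => ?_⟩
  have k1 := h1 i hi n
  have k2 := h2 i hi n
  have c1 := continuous_dfun (j := 1) (by norm_num; linarith) i.1
  have c2 := continuous_dfun (j := 2) (by norm_num; linarith) i.1
  have cc := Complex.continuous_conj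
  have c1' : Continuous fun x => conj (dfun 1 i.1 x) := cc.comp c1
  have c2' : Continuous fun x => conj (dfun 2 i.1 x) := cc.comp c2
  have cD := continuous_nonlinDeriv hs F i.1
  have ce := continuous_expi (-n)
  have cg := hg.smooth.continuous
  have ca := sa.continuous
  have cb := sb.continuous
  have cη := (hg.smooth.mul (SmoothPeriodic.expi (-n)))
  have cη'' := cη.deriv.deriv.continuous
  have cag' := sag.deriv.continuous
  have cbg' := sbg.deriv.continuous
  -- These two vanishing integrals are subtracted, which moves the derivative from v and conj v onto
  -- the frozen coefficients.
  have i1 := integralTorus_ibp_expi _ _ (hasDerivAt_dfun (j := 1) (by norm_num; linarith) i.1) c2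
    (periodic_dfun 1 i.1) sag n
  have i2 := integralTorus_ibp_expi (fun x => conj (dfun 1 i.1 x)) (fun x => conj (dfun 2 i.1 x))
    (fun x => Complex.conjCLE.toContinuousLinearMap.hasFDerivAt.comp_hasDerivAt x
      (hasDerivAt_dfun (j := 1) (by norm_num; linarith) i.1 x)) c2'
    (fun x => by simp only [periodic_dfun 1 i.1 x]) sbg n
  have hn0 := (bracket_rpow_pos n (1 - s)).le
  have hn1 := (bracket_rpow_pos n (2 - s)).le
  have hδ := hi.2.1.nonneg
  have hsum : ‖integralTorus (fun x => dfun 1 i.1 x * deriv (deriv fun x => g x * expi (-n) x) x) * -I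
        + integralTorus (fun x => nonlinDeriv F i.1 x * (g x * expi (-n) x))
        - ((I * n ^ 2 + I * n * m) * integralTorus (fun x => dfun 1 i.1 x * (g x * expi (-n) x))
          + I * n * integralTorus (fun x => conj (dfun 1 i.1 x) * ((b x * g x) * expi (-n) x)))‖
      ≤ C1 * 1 * bracket n ^ (-(s - 1)) + C2 * i.2 * bracket n ^ (-(s - 2)) := by
    refine le_trans (le_of_eq (congrArg _ ?_)) ((norm_add_le _ _).trans (add_le_add k1 k2))
    refine Eq.trans ?_ (integralTorus_add ((X1.continuous hi).mul ce) ((X2.continuous hi).mul ce))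
    have C1 : Continuous fun x => dfun 1 i.1 x * deriv (deriv fun x => g x * expi (-n) x) x :=
      c1.mul cη''
    have C2 : Continuous fun x => nonlinDeriv F i.1 x * (g x * expi (-n) x) := cD.mul (cg.mul ce)
    have C3 : Continuous fun x => dfun 1 i.1 x * (g x * expi (-n) x) := c1.mul (cg.mul ce)
    have C4 : Continuous fun x => conj (dfun 1 i.1 x) * ((b x * g x) * expi (-n) x) :=
      c1'.mul ((cb.mul cg).mul ce)
    have cn : Continuous fun _ : ℝ => I * (n : ℂ) := continuous_const
    have C5 : Continuous fun x => (dfun 2 i.1 x * (a x * g x) + dfun 1 i.1 x *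
        (deriv (fun x => a x * g x) x - I * n * (a x * g x))) * expi (-n) x :=
      ((c2.mul (ca.mul cg)).add (c1.mul (cag'.sub (cn.mul (ca.mul cg))))).mul ce
    have C6 : Continuous fun x => (conj (dfun 2 i.1 x) * (b x * g x) + conj (dfun 1 i.1 x) *
        (deriv (fun x => b x * g x) x - I * n * (b x * g x))) * expi (-n) x :=
      ((c2'.mul (cb.mul cg)).add (c1'.mul (cbg'.sub (cn.mul (cb.mul cg))))).mul ce
    rw [integralTorus_lincomb C1 C2 C3 C4 C5 C6 i1 i2]
    refine congrArg _ (funext fun x => ?_)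
    rw [deriv_deriv_expi_mul hg.smooth, hg.deriv_eq]
    simp only [nonlinDeriv]
    linear_combination (I * (n : ℂ) * (a x - m) * g x * dfun 1 i.1 x * expi (-n) x) * I_sq
  rw [mul_comm (-I)]
  refine hsum.trans ?_
  rw [neg_sub, neg_sub]
  nlinarith [mul_nonneg hC1 (mul_nonneg hδ hn1), mul_nonneg hC2 hn0]

/-- Only the leading rotation -in² is kept. The loss of a power of ⟨n⟩ in the error is harmless,
since this quantity enters later divided by 2n. -/
theorem exists_conj_estimate (hs : 5 / 2 < s) (F : MvPolynomial (Fin 4) ℂ) {h : ℝ → ℂ}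
    (hh : SmoothPeriodic h) (M : ℝ) : ∃ C : ℝ, 0 ≤ C ∧ ∀ u : Sobolev s, ‖u‖ ≤ M → ∀ n : ℤ,
      ‖(I * integralTorus (fun x => conj (dfun 1 u x) * deriv (deriv fun x => h x * expi (-n) x) x)
        + integralTorus (fun x => conj (nonlinDeriv F u x) * (h x * expi (-n) x)))
        - (-I * n ^ 2) * integralTorus (fun x => conj (dfun 1 u x) * (h x * expi (-n) x))‖
      ≤ C * bracket n ^ (2 - s) := by
  have hM : ∀ u : Sobolev s, ‖u‖ ≤ M → ‖u‖ ≤ M := fun u hu => hu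
  have d1 : FamilyDecay (fun u : Sobolev s => ‖u‖ ≤ M) (s - 1) (fun _ => 1) (fun u => dfun 1 u) :=
    (familyDecay_dfun (j := 1) (by norm_num; linarith) hM).mono (by norm_num)
  have fD := familyDecay_nonlinDeriv hs F hM
  have sm : ∀ {f : ℝ → ℂ}, SmoothPeriodic f → ∀ σ,
      FamilyDecay (fun u : Sobolev s => ‖u‖ ≤ M) σ (fun _ => 1) (fun _ => f) :=
    fun hf σ => FamilyDecay.of_smooth hf _ σ
  have X1 := (sm hh.deriv (s - 1)).mul_one (by linarith) (by linarith) le_rfl d1.conj_apply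
  have X2 := (((sm hh.deriv.deriv (s - 1)).mul_one (by linarith) (by linarith) (by linarith)
    (d1.conj_apply.mono (by linarith : s - 2 ≤ s - 1))).const_mul I).add
    ((sm hh (s - 1)).mul_one (by linarith) (by linarith) (by linarith) fD.conj_apply)
  obtain ⟨C1, hC1, h1⟩ := X1.exists_norm_integral_le
  obtain ⟨C2, hC2, h2⟩ := X2.exists_norm_integral_le
  refine ⟨2 * C1 + C2, by positivity, fun u hu n => ?_⟩
  have k1 := h1 u hu n
  have k2 := h2 u hu n
  have c1' : Continuous fun x => conj (dfun 1 u x) :=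
    Complex.continuous_conj.comp (continuous_dfun (j := 1) (by norm_num; linarith) u)
  have cD : Continuous fun x => conj (nonlinDeriv F u x) :=
    Complex.continuous_conj.comp (continuous_nonlinDeriv hs F u)
  have ce := continuous_expi (-n)
  have ch := hh.continuous
  have ch' := hh.deriv.continuous
  have ch'' := hh.deriv.deriv.continuous
  have cη'' := (hh.mul (SmoothPeriodic.expi (-n))).deriv.deriv.continuous
  -- The cross term 2nh' costs one bracket over the order 1 - s.
  have k3 : ‖2 * (n : ℂ)‖ * (C1 * 1 * bracket n ^ (-(s - 1))) ≤ 2 * C1 * bracket n ^ (2 - s) := by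
    have : bracket n ^ (2 - s) = bracket n * bracket n ^ (-(s - 1)) := by
      rw [← Real.rpow_one_add' (bracket_pos n).le (by linarith)]
      congr 1; ring
    rw [this, norm_mul, Complex.norm_intCast, Complex.norm_ofNat, mul_one]
    have := mul_le_mul_of_nonneg_right (abs_le_bracket n)
      (mul_nonneg hC1 (bracket_rpow_pos n (-(s - 1))).le)
    nlinarith
  have k4 := (norm_mul_le (2 * (n : ℂ)) _).trans ((mul_le_mul_of_nonneg_left k1 (norm_nonneg _)).trans k3)
  have k5 := (norm_add_le _ _).trans (add_le_add k4 k2)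
  rw [mul_one, neg_sub, ← add_mul] at k5
  refine le_trans (le_of_eq (congrArg _ ?_)) k5
  rw [← integralTorus_const_mul, ← integralTorus_const_mul, ← integralTorus_const_mul,
    ← integralTorus_add (by fun_prop) (by fun_prop), ← integralTorus_add (by fun_prop) (by fun_prop),
    ← integralTorus_sub (by fun_prop) (by fun_prop)]
  refine congrArg _ (funext fun x => ?_)
  rw [deriv_deriv_expi_mul hh]
  linear_combination (-2 * (n : ℂ) * deriv h x * conj (dfun 1 u x) * expi (-n) x) * I_sq

end

/-! ### Growing modes read backward in time -/

section

open Sobolev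

variable {s : ℝ}

/-- The function e^{-νt}Z has derivative e^{-νt}R, bounded by B as Re ν ≥ 0. A growing mode thus has
an exponentially small initial value, up to the forcing. -/
theorem norm_zero_le_of_hasDerivWithinAt {Z R : ℝ → ℂ} {ν : ℂ} {t₁ B : ℝ} (ht₁ : 0 ≤ t₁)
    (h : ∀ t ∈ Icc 0 t₁, HasDerivWithinAt Z (ν * Z t + R t) (Icc 0 t₁) t) (hν : 0 ≤ ν.re)
    (hR : ∀ t ∈ Icc 0 t₁, ‖R t‖ ≤ B) : ‖Z 0‖ ≤ Real.exp (-ν.re * t₁) * ‖Z t₁‖ + B * t₁ := by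
  have he : ∀ t : ℝ, ‖cexp (-ν * t)‖ = Real.exp (-ν.re * t) := fun t => by
    rw [Complex.norm_exp]; simp
  have hd : ∀ t ∈ Icc 0 t₁, HasDerivWithinAt (fun t : ℝ => cexp (-ν * t) * Z t)
      (cexp (-ν * t) * R t) (Icc 0 t₁) t := fun t ht => by
    have h1 : HasDerivAt (fun t : ℝ => -ν * (t : ℂ)) (-ν) t := by
      simpa using (Complex.ofRealCLM.hasDerivAt (x := t)).const_mul (-ν)
    refine (h1.cexp.hasDerivWithinAt.mul (h t ht)).congr_deriv ?_
    ring
  have := (convex_Icc 0 t₁).norm_image_sub_le_of_norm_hasDerivWithin_le (C := B) hd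
    (fun t ht => by
      rw [norm_mul, he]
      refine (mul_le_of_le_one_left (norm_nonneg _) ?_).trans (hR t ht)
      exact Real.exp_le_one_iff.2 (by nlinarith [ht.1])) ⟨ht₁, le_rfl⟩ ⟨le_rfl, ht₁⟩
  rw [zero_sub, norm_neg, Real.norm_of_nonneg ht₁] at this
  calc ‖Z 0‖ = ‖cexp (-ν * (0 : ℝ)) * Z 0‖ := by simp
    _ ≤ ‖cexp (-ν * t₁) * Z t₁‖
        + ‖cexp (-ν * (0 : ℝ)) * Z 0 - cexp (-ν * t₁) * Z t₁‖ := norm_le_insert' _ _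
    _ ≤ _ := by rw [norm_mul, he]; gcongr

theorem integralTorus_dfun_zero_mul_expi (hs : 1 / 2 < s) (u : Sobolev s) (k : ℤ) :
    integralTorus (fun x => dfun 0 u x * expi (-k) x) = coef u k := by
  have := integralTorus_fseries (summable_dcoef (j := 0) (by simpa using hs) u) k
  simpa [dfun] using this

theorem deriv_deriv_expi (k : ℤ) (x : ℝ) : deriv (deriv (expi k)) x = -(k : ℂ) ^ 2 * expi k x := by
  have : deriv (expi k) = fun x => I * k * expi k x := funext fun x => (hasDerivAt_expi k x).deriv
  rw [this, ((hasDerivAt_expi k x).const_mul (I * (k : ℂ))).deriv]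
  linear_combination (k : ℂ) ^ 2 * expi k x * I_sq

/-- Testing with e^{-ikx} gives an ordinary differential equation for the coefficient, in which ∂ₓ²
costs ⟨k⟩². -/
theorem exists_coef_sub_le_time (hs : 5 / 2 < s) (F : MvPolynomial (Fin 4) ℂ) (M : ℝ) :
    ∃ C : ℝ, 0 ≤ C ∧ ∀ {ε τ : ℝ} {φ : Sobolev s} {y : ℝ → Sobolev s}, |ε| = 1 →
      (∀ t, ‖y t‖ ≤ M) → IsEvolution F ε τ φ y → ∀ t ∈ Icc 0 τ, ∀ k,
      ‖coef (y t) k - coef φ k‖ ≤ C * t * bracket k ^ (2 : ℝ) := by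
  have hM : ∀ u : Sobolev s, ‖u‖ ≤ M → ‖u‖ ≤ M := fun u hu => hu
  obtain ⟨C, hC, hN⟩ := (familyDecay_nonlinFun hs F hM).exists_norm_integral_le
  refine ⟨|M| + C, by positivity, fun {ε τ φ y} hε hy h t ht k => ?_⟩
  have h1 := h _ (SmoothPeriodic.expi (-k))
  have hs' : 1 / 2 < s := by linarith
  simp only [integralTorus_dfun_zero_mul_expi hs'] at h1
  rw [← h1.1]
  have hk1 : (1 : ℝ) ≤ bracket k ^ (2 : ℝ) := Real.one_le_rpow (one_le_bracket k) (by norm_num)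
  have := (convex_Icc 0 τ).norm_image_sub_le_of_norm_hasDerivWithin_le
    (C := (|M| + C) * bracket k ^ (2 : ℝ)) h1.2 (fun t' _ => by
      rw [norm_mul, Complex.norm_real, Real.norm_eq_abs, hε, one_mul]
      refine (norm_add_le _ _).trans ?_
      rw [add_mul]
      refine add_le_add ?_ ?_
      · have e : (fun x => dfun 0 (y t') x * deriv (deriv (expi (-k))) x)
            = fun x => -(k : ℂ) ^ 2 * (dfun 0 (y t') x * expi (-k) x) := by
          funext x; rw [deriv_deriv_expi]; push_cast; ring
        rw [e, integralTorus_const_mul, integralTorus_dfun_zero_mul_expi hs', norm_mul, norm_neg,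
          norm_I, one_mul, norm_mul, norm_neg, norm_pow, Complex.norm_intCast, mul_comm]
        have h2 : ‖coef (y t') k‖ ≤ |M| := by
          refine (norm_coef_le _ k).trans ?_
          refine (mul_le_of_le_one_right (norm_nonneg _) ?_).trans ((hy t').trans (le_abs_self M))
          simpa using bracket_rpow_le_rpow k (by linarith : -s ≤ 0)
        have h3 : |(k : ℝ)| ^ 2 ≤ bracket k ^ (2 : ℝ) := by
          rw [Real.rpow_two]
          exact pow_le_pow_left₀ (abs_nonneg _) (abs_le_bracket k) 2
        gcongr
      · refine (hN _ (hy t') k).trans ?_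
        rw [mul_one]
        exact mul_le_mul_of_nonneg_left (bracket_rpow_le_rpow k (by linarith)) hC) ⟨le_rfl, ht.1.trans ht.2⟩ ht
  rw [sub_zero, Real.norm_of_nonneg ht.1] at this
  linarith

/-- Interpolation with weight γ between the rate t⟨k⟩² and the a priori bound ⟨k⟩^{-s}. The exponent
γ is fixed by γ(s + 2) = 1/2, that is, by a loss of half a derivative. -/
theorem exists_coef_sub_le (hs : 5 / 2 < s) (F : MvPolynomial (Fin 4) ℂ) (M : ℝ) :
    ∃ C : ℝ, 0 ≤ C ∧ ∀ {ε τ : ℝ} {φ : Sobolev s} {y : ℝ → Sobolev s}, |ε| = 1 →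
      (∀ t, ‖y t‖ ≤ M) → IsEvolution F ε τ φ y → ∀ t ∈ Icc 0 τ, ∀ k,
      ‖coef (y t) k - coef φ k‖ ≤ C * t ^ (1 / (2 * (s + 2))) * bracket k ^ (-(s - 1 / 2)) := by
  obtain ⟨C, hC, h⟩ := exists_coef_sub_le_time hs F M
  set γ := 1 / (2 * (s + 2)) with hγ
  have hs2 : 0 < s + 2 := by linarith
  have hγ0 : 0 < γ := by positivity
  have hγ1 : γ < 1 := by rw [hγ, div_lt_one (by positivity)]; linarith
  have hγs : γ * (s + 2) = 1 / 2 := by rw [hγ]; field_simp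
  refine ⟨C ^ γ * (2 * |M|) ^ (1 - γ), by positivity, fun {ε τ φ y} hε hy hev t ht k => ?_⟩
  have h1 := h hε hy hev t ht k
  have hk := bracket_pos k
  -- No bound on φ is assumed; it has the coefficients of y(0), which is bounded by M.
  have hφ : coef φ k = coef (y 0) k := by
    have := (hev _ (SmoothPeriodic.expi (-k))).1
    simpa only [integralTorus_dfun_zero_mul_expi (by linarith : 1 / 2 < s)] using this.symm
  have h2 : ‖coef (y t) k - coef φ k‖ ≤ 2 * |M| * bracket k ^ (-s) := by
    have hb : ∀ t, ‖coef (y t) k‖ ≤ |M| * bracket k ^ (-s) := fun t =>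
      (norm_coef_le _ k).trans (mul_le_mul_of_nonneg_right ((hy t).trans (le_abs_self M))
        (bracket_rpow_pos k _).le)
    rw [hφ]
    refine (norm_sub_le _ _).trans ((add_le_add (hb t) (hb 0)).trans_eq (by ring))
  set d := ‖coef (y t) k - coef φ k‖ with hd
  have hd0 : 0 ≤ d := norm_nonneg _
  have e : d = d ^ γ * d ^ (1 - γ) := by
    rw [← Real.rpow_add_of_nonneg hd0 hγ0.le (by linarith)]; simp
  rw [e]
  calc d ^ γ * d ^ (1 - γ)
      ≤ (C * t * bracket k ^ (2 : ℝ)) ^ γ * (2 * |M| * bracket k ^ (-s)) ^ (1 - γ) := by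
        have := ht.1
        gcongr
    _ = C ^ γ * (2 * |M|) ^ (1 - γ) * t ^ γ * bracket k ^ (-(s - 1 / 2)) := by
        have e1 : (bracket k ^ (2 : ℝ)) ^ γ * (bracket k ^ (-s)) ^ (1 - γ)
            = bracket k ^ (-(s - 1 / 2)) := by
          rw [← Real.rpow_mul hk.le, ← Real.rpow_mul hk.le, ← Real.rpow_add hk]
          congr 1
          linear_combination hγs
        rw [Real.mul_rpow (mul_nonneg hC ht.1) (bracket_rpow_pos k _).le, Real.mul_rpow hC ht.1,
          Real.mul_rpow (by positivity) (bracket_rpow_pos k _).le, ← e1]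
        ring

theorem isClose_of_coef (hs : 5 / 2 < s) {φ₀ u : Sobolev s} {M δ : ℝ} (hu : ‖u‖ ≤ M)
    (h : ∀ k, ‖coef u k - coef φ₀ k‖ ≤ δ * bracket k ^ (-(s - 1 / 2))) : IsClose φ₀ M (u, δ) := by
  have h0 : ∀ k, ‖coef (u - φ₀) k‖ ≤ δ * bracket k ^ (-(s - 1 / 2)) := fun k => by
    rw [coef_sub]; exact h k
  refine ⟨hu, ?_, ?_⟩
  · have := hasDecay_dfun (j := 0) (σ := s - 1 / 2) (M := δ) (by norm_num; linarith) (u := u - φ₀)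
      (by simpa using h0)
    rw [show dfun 0 (u - φ₀) = fun x => dfun 0 u x - dfun 0 φ₀ x from
      funext (dfun_sub (by norm_num; linarith) _ _)] at this
    exact this.mono (by linarith) le_rfl
  · have := hasDecay_dfun (j := 1) (σ := s - 3 / 2) (M := δ) (by norm_num; linarith) (u := u - φ₀)
      (by
        intro k
        have e : -(s - 3 / 2 + (1 : ℕ)) = -(s - 1 / 2) := by push_cast; ring
        rw [e]; exact h0 k)
    rw [show dfun 1 (u - φ₀) = fun x => dfun 1 u x - dfun 1 φ₀ x from
      funext (dfun_sub (by norm_num; linarith) _ _)] at this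
    exact this

/-- For λ = in² + inm the corrected quantity Z = V + W/(2n) solves Z' = ε(λZ + R), and the sign
condition gives Re(ελ) = |n||Im m|. In the bound, the exponential damps Z(t₁), the two terms with t₁
integrate R (its second part is the freezing error, one bracket worse), and ⟨n⟩⁻¹ pays for
W(0)/(2n). -/
theorem exists_high_frequency_bound (hs : 5 / 2 < s) {F : MvPolynomial (Fin 4) ℂ} {φ₀ : Sobolev s}
    {m : ℂ} {g : ℝ → ℂ} (hg : IsGauge F φ₀ m g) (M : ℝ) : ∃ C : ℝ, 0 ≤ C ∧
      ∀ {ε τ : ℝ} {φ : Sobolev s} {y : ℝ → Sobolev s}, |ε| = 1 → (∀ t, ‖y t‖ ≤ M) →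
      IsEvolution F ε τ φ y → ∀ n : ℤ, n ≠ 0 → 0 ≤ -(ε * n * m.im) → ∀ δ₀ : ℝ, 0 ≤ δ₀ →
      (∀ k, ‖coef φ k - coef φ₀ k‖ ≤ δ₀ * bracket k ^ (-(s - 1 / 2))) → ∀ t₁ ∈ Icc 0 τ,
      ‖integralTorus (fun x => dfun 1 φ x * (g x * expi (-n) x))‖ ≤ C * bracket n ^ (1 - s) *
        (Real.exp (-(|(n : ℝ)| * |m.im|) * t₁) + t₁
          + t₁ * (δ₀ + t₁ ^ (1 / (2 * (s + 2)))) * bracket n + (bracket n)⁻¹) := by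
  have hM : ∀ u : Sobolev s, ‖u‖ ≤ M → ‖u‖ ≤ M := fun u hu => hu
  have sb := hg.smooth_nonlinFun (MvPolynomial.pderiv 3 F)
  have sh := sb.mul hg.smooth
  have d1 : FamilyDecay (fun u : Sobolev s => ‖u‖ ≤ M) (s - 1) (fun _ => 1) (fun u => dfun 1 u) :=
    (familyDecay_dfun (j := 1) (by norm_num; linarith) hM).mono (by norm_num)
  obtain ⟨CV, hCV, hV⟩ := (d1.mul_one (by linarith) (by linarith) le_rfl
    (FamilyDecay.of_smooth hg.smooth _ _)).exists_norm_integral_le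
  obtain ⟨CW, hCW, hW⟩ := (d1.conj_apply.mul_one (by linarith) (by linarith) le_rfl
    (FamilyDecay.of_smooth sh _ _)).exists_norm_integral_le
  obtain ⟨CE, hCE, hE⟩ := exists_gauge_estimate hs hg M
  obtain ⟨CK, hCK, hK⟩ := exists_conj_estimate hs F sh M
  obtain ⟨CT, hCT, hT⟩ := exists_coef_sub_le hs F M
  set γ := 1 / (2 * (s + 2)) with hγ
  refine ⟨CV + CW + (CE * (1 + CT) + CK + ‖m‖ * CW), by positivity, ?_⟩
  intro ε τ φ y hε hy hev n hn hsign δ₀ hδ₀ hφ t₁ ht₁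
  have hevt := hev.mono ht₁.2
  set b : ℝ → ℂ := nonlinFun (MvPolynomial.pderiv 3 F) φ₀ with hb
  have ht0 := ht₁.1
  have hγ0 : 0 < γ := by
    have : 0 < s + 2 := by linarith
    positivity
  set X := bracket n ^ (1 - s) with hX
  have hXpos : 0 < X := bracket_rpow_pos n _
  have hbn := bracket_pos n
  have hX2 : bracket n ^ (2 - s) = X * bracket n := by
    rw [hX, ← Real.rpow_add_one hbn.ne']; congr 1; ring
  -- Distance to φ₀ over all of [0, t₁]: the initial distance plus the Hölder drift.
  set δ := δ₀ + CT * t₁ ^ γ with hδ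
  have hδ0 : 0 ≤ δ := by positivity
  have hclose : ∀ t ∈ Icc 0 t₁, IsClose φ₀ M (y t, δ) := fun t ht =>
    isClose_of_coef hs (hy t) fun k => by
      have h1 := hT hε hy hevt t ht k
      have h2 := hφ k
      have h3 : t ^ γ ≤ t₁ ^ γ := Real.rpow_le_rpow ht.1 ht.2 hγ0.le
      have h4 := bracket_rpow_pos k (-(s - 1 / 2))
      calc ‖coef (y t) k - coef φ₀ k‖ ≤ ‖coef (y t) k - coef φ k‖ + ‖coef φ k - coef φ₀ k‖ :=
            norm_sub_le_norm_sub_add_norm_sub _ _ _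
        _ ≤ CT * t ^ γ * bracket k ^ (-(s - 1 / 2)) + δ₀ * bracket k ^ (-(s - 1 / 2)) :=
            add_le_add h1 h2
        _ ≤ CT * t₁ ^ γ * bracket k ^ (-(s - 1 / 2)) + δ₀ * bracket k ^ (-(s - 1 / 2)) := by gcongr
        _ = δ * bracket k ^ (-(s - 1 / 2)) := by rw [hδ]; ring
  set V : ℝ → ℂ := fun t => integralTorus (fun x => dfun 1 (y t) x * (g x * expi (-n) x)) with hVd
  set W : ℝ → ℂ := fun t =>
    integralTorus (fun x => conj (dfun 1 (y t) x) * ((b x * g x) * expi (-n) x)) with hWd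
  have hVb : ∀ t, ‖V t‖ ≤ CV * X := fun t => by
    have := hV (y t) (hy t) n
    rw [mul_one, neg_sub] at this
    simpa only [hVd, mul_assoc] using this
  have hWb : ∀ t, ‖W t‖ ≤ CW * X := fun t => by
    have := hW (y t) (hy t) n
    rw [mul_one, neg_sub] at this
    simpa only [hWd, mul_assoc] using this
  have hnC : (n : ℂ) ≠ 0 := by exact_mod_cast hn
  have hn1 : (1 : ℝ) ≤ |(n : ℝ)| := by exact_mod_cast Int.one_le_abs hn
  have hbn2 : bracket n ≤ 2 * |(n : ℝ)| := by linarith [bracket_le_one_add_abs n]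
  have hinv : ‖(2 * (n : ℂ))⁻¹‖ ≤ (bracket n)⁻¹ := by
    rw [norm_inv, norm_mul, Complex.norm_intCast, Complex.norm_ofNat]
    exact inv_anti₀ hbn hbn2
  have hinv1 : ‖(2 * (n : ℂ))⁻¹‖ ≤ 1 := hinv.trans (inv_le_one_of_one_le₀ (one_le_bracket n))
  set V' : ℝ → ℂ := fun t =>
    -I * integralTorus (fun x => dfun 1 (y t) x * deriv (deriv fun x => g x * expi (-n) x) x)
      + integralTorus (fun x => nonlinDeriv F (y t) x * (g x * expi (-n) x)) with hV'
  set W' : ℝ → ℂ := fun t =>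
    I * integralTorus (fun x =>
        conj (dfun 1 (y t) x) * deriv (deriv fun x => (b x * g x) * expi (-n) x) x)
      + integralTorus (fun x => conj (nonlinDeriv F (y t) x) * ((b x * g x) * expi (-n) x)) with hW'
  set lam : ℂ := I * n ^ 2 + I * n * m with hlam
  -- The n-order terms in W cancel: in - in²/(2n) = in/2 matches λ/(2n) up to im/(2n)·n = im/2,
  -- which is the last term.
  set R : ℝ → ℂ := fun t => (V' t - (lam * V t + I * n * W t))
    + ((2 * (n : ℂ))⁻¹ * (W' t - -I * n ^ 2 * W t) - I * m / 2 * W t) with hR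
  have hRb : ∀ t ∈ Icc 0 t₁, ‖ε * R t‖ ≤ (CE * (1 + δ * bracket n) + CK + ‖m‖ * CW) * X := by
    intro t ht
    have h1 := hE _ (hclose t ht) n
    have h2 := hK (y t) (hy t) n
    rw [hX2] at h1 h2
    have h3 : ‖(2 * (n : ℂ))⁻¹ * (W' t - -I * n ^ 2 * W t)‖ ≤ CK * X := by
      rw [norm_mul]
      calc ‖(2 * (n : ℂ))⁻¹‖ * ‖W' t - -I * n ^ 2 * W t‖
          ≤ (bracket n)⁻¹ * (CK * (X * bracket n)) :=
            mul_le_mul hinv h2 (norm_nonneg _) (by positivity)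
        _ = CK * X := by field_simp
    have h4 : ‖I * m / 2 * W t‖ ≤ ‖m‖ * (CW * X) := by
      rw [norm_mul, norm_div, norm_mul, norm_I, one_mul, Complex.norm_ofNat]
      refine mul_le_mul ?_ (hWb t) (norm_nonneg _) (norm_nonneg _)
      linarith [norm_nonneg m]
    rw [norm_mul, Complex.norm_real, Real.norm_eq_abs, hε, one_mul]
    refine (norm_add_le _ _).trans ((add_le_add h1 ((norm_sub_le _ _).trans (add_le_add h3 h4))).trans
      (le_of_eq ?_))
    ring
  have hZd : ∀ t ∈ Icc 0 t₁, HasDerivWithinAt (fun t => V t + (2 * (n : ℂ))⁻¹ * W t)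
      (ε * lam * (V t + (2 * (n : ℂ))⁻¹ * W t) + ε * R t) (Icc 0 t₁) t := by
    intro t ht
    have h1 := hevt.hasDerivWithinAt_dfun_one hs (hg.smooth.mul (SmoothPeriodic.expi (-n))) ht
    have h2 := hevt.hasDerivWithinAt_conj_dfun_one hs (sh.mul (SmoothPeriodic.expi (-n))) ht
    refine (h1.add (h2.const_mul ((2 * (n : ℂ))⁻¹))).congr_deriv ?_
    change ε * V' t + (2 * (n : ℂ))⁻¹ * (ε * W' t) = _
    simp only [hR, hlam]
    field_simp
    ring
  have hre : (ε * lam).re = |(n : ℝ)| * |m.im| := by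
    have h1 : ((ε : ℂ) * lam).re = -(ε * n * m.im) := by
      simp [hlam, pow_two]
      ring
    rw [h1, ← abs_of_nonneg hsign, abs_neg, abs_mul, abs_mul, hε, one_mul]
  have hfin := norm_zero_le_of_hasDerivWithinAt (R := fun t => ε * R t) ht0 hZd
    (hre ▸ by positivity) hRb
  have hZb : ‖V t₁ + (2 * (n : ℂ))⁻¹ * W t₁‖ ≤ (CV + CW) * X := by
    refine (norm_add_le _ _).trans ?_
    rw [norm_mul, add_mul]
    exact add_le_add (hVb _) ((mul_le_of_le_one_left (norm_nonneg _) hinv1).trans (hWb _))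
  have hV0 : integralTorus (fun x => dfun 1 φ x * (g x * expi (-n) x)) = V 0 :=
    (hev.integral_dfun_one_zero hs (hg.smooth.mul (SmoothPeriodic.expi (-n)))).symm
  rw [hV0]
  have hW0 : ‖(2 * (n : ℂ))⁻¹ * W 0‖ ≤ (bracket n)⁻¹ * (CW * X) := by
    rw [norm_mul]; exact mul_le_mul hinv (hWb 0) (norm_nonneg _) (by positivity)
  rw [hre] at hfin
  set Ex := Real.exp (-(|(n : ℝ)| * |m.im|) * t₁) with hEx
  have hEx0 : 0 < Ex := Real.exp_pos _
  have hV0' : ‖V 0‖ ≤ ‖V 0 + (2 * (n : ℂ))⁻¹ * W 0‖ + ‖(2 * (n : ℂ))⁻¹ * W 0‖ := by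
    simpa using norm_sub_le (V 0 + (2 * (n : ℂ))⁻¹ * W 0) ((2 * (n : ℂ))⁻¹ * W 0)
  have hinvpos : 0 < (bracket n)⁻¹ := by positivity
  have htγ : 0 ≤ t₁ ^ γ := by positivity
  obtain ⟨K, hKd⟩ : ∃ K, K = CV + CW + (CE * (1 + CT) + CK + ‖m‖ * CW) := ⟨_, rfl⟩
  rw [← hKd]
  calc ‖V 0‖ ≤ Ex * ((CV + CW) * X) + (CE * (1 + δ * bracket n) + CK + ‖m‖ * CW) * X * t₁
        + (bracket n)⁻¹ * (CW * X) := by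
        refine hV0'.trans (add_le_add (hfin.trans ?_) hW0)
        gcongr
    _ = X * ((CV + CW) * Ex + (CE + CK + ‖m‖ * CW) * t₁
          + (CE * (t₁ * δ₀ * bracket n) + CE * CT * (t₁ * t₁ ^ γ * bracket n))
          + CW * (bracket n)⁻¹) := by rw [hδ]; ring
    _ ≤ X * (K * Ex + K * t₁ + (K * (t₁ * δ₀ * bracket n) + K * (t₁ * t₁ ^ γ * bracket n))
          + K * (bracket n)⁻¹) := by
        have hm := mul_nonneg (norm_nonneg m) hCW
        have hc := mul_nonneg hCE hCT
        have k1 : CV + CW ≤ K := by rw [hKd]; linarith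
        have k2 : CE + CK + ‖m‖ * CW ≤ K := by rw [hKd]; linarith
        have k3 : CE ≤ K := by rw [hKd]; linarith
        have k4 : CE * CT ≤ K := by rw [hKd]; linarith
        have k5 : CW ≤ K := by rw [hKd]; linarith
        gcongr
    _ = _ := by ring

end

/-! ### A ball of data without solutions -/

section

open Sobolev Filter Topology

variable {s : ℝ}

/-- Since a - m has mean zero, its primitive G is smooth and periodic, and g = exp(iG/2) solves the
gauge equation without zeros. -/
theorem exists_isGauge (F : MvPolynomial (Fin 4) ℂ) {φ₀ : Sobolev s}
    (h : (Function.support (coef φ₀)).Finite) : ∃ g : ℝ → ℂ,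
      IsGauge F φ₀ (integralTorus (nonlinFun (MvPolynomial.pderiv 1 F) φ₀)) g ∧ ∀ x, g x ≠ 0 := by
  set a : ℝ → ℂ := nonlinFun (MvPolynomial.pderiv 1 F) φ₀ with ha
  set m := integralTorus a with hm
  have sa : SmoothPeriodic a :=
    SmoothPeriodic.evalPoly _ (smoothPeriodic_dfun h 0) (smoothPeriodic_dfun h 1)
  have sam : SmoothPeriodic fun x => a x + -m := sa.add (SmoothPeriodic.const (-m))
  set G : ℝ → ℂ := fun x => ∫ y in (0 : ℝ)..x, (a y + -m) with hG
  have hGd : ∀ x, HasDerivAt G (a x + -m) x := fun x =>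
    intervalIntegral.integral_hasDerivAt_right (sam.continuous.intervalIntegrable _ _)
      sam.continuous.aestronglyMeasurable.stronglyMeasurableAtFilter sam.continuous.continuousAt
  have hG' : deriv G = fun x => a x + -m := funext fun x => (hGd x).deriv
  have sG : SmoothPeriodic G := by
    refine ⟨contDiff_infty_iff_deriv.2 ⟨fun x => (hGd x).differentiableAt, hG' ▸ sam.contDiff⟩,
      fun x => ?_⟩
    have h1 := sam.periodic.intervalIntegral_add_eq x (-Real.pi)
    rw [show -Real.pi + 2 * Real.pi = Real.pi by ring] at h1
    have h2 : ∫ x in (-Real.pi)..Real.pi, (a x + -m) = 0 := by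
      rw [intervalIntegral.integral_add (sa.continuous.intervalIntegrable _ _)
        intervalIntegrable_const, intervalIntegral.integral_const, hm, integralTorus]
      have := Real.pi_pos.ne'
      rw [smul_neg, smul_smul, show (Real.pi - -Real.pi) * (2 * Real.pi)⁻¹ = 1 by field_simp; ring,
        one_smul, add_neg_cancel]
    have h3 := intervalIntegral.integral_add_adjacent_intervals
      (sam.continuous.intervalIntegrable 0 x) (sam.continuous.intervalIntegrable (μ := volume) x (x + 2 * Real.pi))
    rw [h1, h2, add_zero] at h3
    exact h3.symm
  refine ⟨fun x => cexp (I / 2 * G x), ⟨smoothPeriodic_dfun h 0, smoothPeriodic_dfun h 1,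
    (sG.const_mul (I / 2)).exp_apply, fun x => ?_⟩, fun x => Complex.exp_ne_zero _⟩
  rw [((hGd x).const_mul (I / 2)).cexp.deriv]
  ring

theorem exists_integral_expi_ne_zero {g : ℝ → ℂ} (hg : SmoothPeriodic g) (h : ∀ x, g x ≠ 0) :
    ∃ k : ℤ, integralTorus (fun x => g x * expi (-k) x) ≠ 0 := by
  by_contra! hk
  obtain ⟨M, c, hc, -, rfl⟩ := hg.exists_hasDecay 0
  have : c = 0 := funext fun k => by rw [← integralTorus_fseries hc k, hk k]; rfl
  exact h 0 (by simp [this, fseries])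

theorem norm_mode (n : ℤ) (a : ℂ) : ‖mode s n a‖ = bracket n ^ s * ‖a‖ := by
  have h : toSeq (mode s n a) = lp.single 2 n (((bracket n ^ s : ℝ) : ℂ) * a) :=
    lp.ext (weightedCoeff_single s n a)
  rw [← norm_toSeq, h, lp.norm_single (by norm_num), norm_mul, Complex.norm_real,
    Real.norm_of_nonneg (bracket_rpow_pos n s).le]

theorem dfun_mode (j : ℕ) (n : ℤ) (a : ℂ) (x : ℝ) :
    dfun j (mode s n a) x = (I * n) ^ j * a * expi n x := by
  rw [dfun, fseries, tsum_eq_single n (fun k hk => by simp [coef_mode, hk])]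
  simp [coef_mode]

/-- With t₁ = R^{γ/4-1} the powers of R that arise are γ/4 - 1/2, γ/4 - 1, γ/2 - 1, γ/2 - 1/2 and
γ²/4 - γ/2, all negative for 0 < γ < 1. The remaining term is R^{γ/4} exp(-bR^{γ/4}). -/
theorem tendsto_rpow_mul_error {γ b : ℝ} (hγ0 : 0 < γ) (hγ1 : γ < 1) (hb : 0 < b) (A B C K : ℝ) :
    Tendsto (fun R : ℝ => R ^ (γ / 4) * (A * R ^ (-(1 / 2) : ℝ) + B * R⁻¹
      + C * (Real.exp (-(b * R) * R ^ (γ / 4 - 1)) + R ^ (γ / 4 - 1)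
        + R ^ (γ / 4 - 1) * (K * R ^ (-(1 / 2) : ℝ) + (R ^ (γ / 4 - 1)) ^ γ) * R + R⁻¹)))
      atTop (𝓝 0) := by
  have hneg : ∀ p : ℝ, p < 0 → Tendsto (fun R : ℝ => R ^ p) atTop (𝓝 0) := fun p hp => by
    simpa using tendsto_rpow_neg_atTop (neg_pos.2 hp)
  have hexp : Tendsto (fun R : ℝ => R ^ (γ / 4) * Real.exp (-b * R ^ (γ / 4))) atTop (𝓝 0) := by
    have h1 := (tendsto_rpow_mul_exp_neg_mul_atTop_nhds_zero 1 b hb).comp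
      (tendsto_rpow_atTop (by positivity : 0 < γ / 4))
    simpa [Function.comp_def] using h1
  have h := (((hneg (γ / 4 - 1 / 2) (by linarith)).const_mul A).add
    ((hneg (γ / 4 - 1) (by linarith)).const_mul B)).add
    (((((hexp.add (hneg (γ / 4 + (γ / 4 - 1)) (by linarith))).add
      ((hneg (γ / 4 + γ / 4 - 1 / 2) (by linarith)).const_mul K)).add
      (hneg (γ / 4 + (γ / 4 + (γ / 4 - 1) * γ)) (by nlinarith))).add
      (hneg (γ / 4 - 1) (by linarith))).const_mul C)
  simp only [mul_zero, add_zero] at h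
  refine h.congr' ?_
  filter_upwards [eventually_gt_atTop 0] with R hR
  have e1 : R ^ (γ / 4 - 1 / 2) = R ^ (γ / 4) * R ^ (-(1 / 2) : ℝ) := by
    rw [← Real.rpow_add hR]; rfl
  have e2 : R ^ (γ / 4 - 1) = R ^ (γ / 4) * R⁻¹ := by
    rw [Real.rpow_sub_one hR.ne']; rfl
  have e3 : R ^ (γ / 4 + (γ / 4 - 1)) = R ^ (γ / 4) * R ^ (γ / 4 - 1) := Real.rpow_add hR _ _
  have e4 : R ^ (γ / 4 + γ / 4 - 1 / 2)
      = R ^ (γ / 4) * (R ^ (γ / 4 - 1) * R ^ (-(1 / 2) : ℝ) * R) := by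
    rw [← Real.rpow_add hR, ← Real.rpow_add_one hR.ne', ← Real.rpow_add hR]
    congr 1; ring
  have e5 : R ^ (γ / 4 + (γ / 4 + (γ / 4 - 1) * γ))
      = R ^ (γ / 4) * (R ^ (γ / 4 - 1) * (R ^ (γ / 4 - 1)) ^ γ * R) := by
    rw [← Real.rpow_mul hR.le, ← Real.rpow_add hR, ← Real.rpow_add_one hR.ne', ← Real.rpow_add hR]
    congr 1; ring
  have e6 : -(b * R) * R ^ (γ / 4 - 1) = -b * R ^ (γ / 4) := by
    rw [e2]; field_simp
  rw [e6, e1, e3, e4, e5, e2]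
  ring

theorem tendsto_bracket_sign_mul {σ : ℤ} (hσ : |σ| = 1) :
    Tendsto (fun N : ℕ => bracket (σ * N)) atTop atTop := by
  refine tendsto_atTop_mono (fun N => ?_) tendsto_natCast_atTop_atTop
  refine le_trans (le_of_eq ?_) (abs_le_bracket _)
  have : |(σ : ℝ)| = 1 := by exact_mod_cast hσ
  push_cast
  rw [abs_mul, this, one_mul, Nat.abs_cast]

/-- The datum φ₀ is perturbed by one mode whose contribution to ∫ ∂ₓφ g e^{-inx} has size
⟨n⟩^{1-s-γ/4}, more than `exists_high_frequency_bound` permits for large |n|. The comparison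
tolerates a further perturbation of size ⟨n⟩^{-1/2}, hence a whole ball. -/
theorem exists_ball_no_evolution (hs : 5 / 2 < s) (F : MvPolynomial (Fin 4) ℂ) {φ₀ : Sobolev s}
    (hfin : (Function.support (coef φ₀)).Finite)
    (hm : (integralTorus (nonlinFun (MvPolynomial.pderiv 1 F) φ₀)).im ≠ 0) {ε : ℝ}
    (hε : ε = 1 ∨ ε = -1) (M : ℝ) {τ r₀ : ℝ} (hτ : 0 < τ) (hr₀ : 0 < r₀) :
    ∃ φ₁ : Sobolev s, ∃ r > 0, Metric.ball φ₁ r ⊆ Metric.ball φ₀ r₀ ∧ ∀ φ ∈ Metric.ball φ₁ r,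
      ¬ ∃ y : ℝ → Sobolev s, (∀ t, ‖y t‖ ≤ M) ∧ IsEvolution F ε τ φ y := by
  set m := integralTorus (nonlinFun (MvPolynomial.pderiv 1 F) φ₀) with hmd
  obtain ⟨g, hg, hg0⟩ := exists_isGauge F hfin
  -- The gauge may lack a mean, so the mode is placed at n - k₀, where ĝ(k₀) ≠ 0.
  obtain ⟨k₀, hk₀⟩ := exists_integral_expi_ne_zero hg.smooth hg0
  set G := integralTorus (fun x => g x * expi (-k₀) x) with hG
  obtain ⟨C, hC, hbound⟩ := exists_high_frequency_bound hs hg M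
  have hsm1 : 1 < s - 1 := by linarith
  obtain ⟨Cg, hCg⟩ := hg.smooth.exists_hasDecay (s - 1)
  obtain ⟨Cm, hCm, hmul⟩ := HasDecay.exists_mul hsm1 (by linarith : 0 ≤ s - 1) le_rfl
  obtain ⟨C₀, hC₀⟩ := (hg.smooth_one.mul hg.smooth).exists_hasDecay s
  set γ := 1 / (2 * (s + 2)) with hγ
  have hs2 : 0 < s + 2 := by linarith
  have hγ0 : 0 < γ := by positivity
  have hγ1 : γ < 1 := by rw [hγ, div_lt_one (by positivity)]; linarith
  set β := 2 * bracket k₀ with hβ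
  have hβ0 : 0 < β := mul_pos two_pos (bracket_pos k₀)
  set c₁ := 1 / 2 * β ^ (1 - s) * ‖G‖ with hc₁
  have hc₁0 : 0 < c₁ := by positivity
  set K := 1 + β ^ (1 / 2 : ℝ) with hK
  have hεabs : |ε| = 1 := by rcases hε with rfl | rfl <;> simp
  -- σ is the sign of the frequencies that grow in the time direction ε.
  obtain ⟨σ, hσ, hsign⟩ : ∃ σ : ℤ, |σ| = 1 ∧ 0 ≤ -(ε * σ * m.im) := by
    rcases le_total (ε * m.im) 0 with h | h
    · exact ⟨1, by simp, by push_cast; linarith⟩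
    · exact ⟨-1, by simp, by push_cast; linarith⟩
  -- The rate is halved because ⟨n⟩ ≤ 2|n| for n ≠ 0.
  have hasym := tendsto_rpow_mul_error hγ0 hγ1 (b := |m.im| / 2) (by positivity)
    (Cm * Cg) C₀ C K
  have hT := tendsto_bracket_sign_mul hσ
  have hneg : ∀ p : ℝ, p < 0 → Tendsto (fun R : ℝ => R ^ p) atTop (𝓝 0) := fun p hp => by
    simpa using tendsto_rpow_neg_atTop (neg_pos.2 hp)
  have ev1 := hT.eventually (hasym.eventually_lt_const hc₁0)
  have ev2 := hT.eventually ((hneg (γ / 4 - 1) (by linarith)).eventually_lt_const hτ)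
  have ev3 := hT.eventually (((hneg (-(γ / 4)) (by linarith)).add
    (hneg (-(1 / 2)) (by norm_num))).eventually_lt_const (by simpa using hr₀))
  -- In turn: the final contradiction, t₁ < τ, the inclusion of balls, and N > |k₀|, which makes
  -- both n and n - k₀ nonzero.
  obtain ⟨N, h1, h2, h3, h4⟩ := (ev1.and (ev2.and (ev3.and
    (eventually_gt_atTop k₀.natAbs)))).exists
  set n : ℤ := σ * N with hn
  set R := bracket n with hR
  have hR0 : 0 < R := bracket_pos n
  have hRi := (bracket_rpow_pos n)
  set n' : ℤ := n - k₀ with hn'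
  have habs : |n| = N := by rw [hn, abs_mul, hσ]; simp
  have hn0 : n ≠ 0 := by
    intro h; rw [h] at habs; simp at habs; omega
  have hn'0 : n' ≠ 0 := by
    intro h
    have : n = k₀ := by omega
    rw [this, Int.abs_eq_natAbs] at habs
    omega
  have hR' : R ≤ bracket n' * β := by
    have := bracket_add_le_mul n' k₀
    rw [hn', sub_add_cancel] at this
    rw [hβ]; linarith
  have hR'' : bracket n' ≤ β * R := by
    have := bracket_add_le_mul n (-k₀)
    rw [bracket_neg, ← sub_eq_add_neg] at this
    rw [hβ]; linarith
  -- Normalized so that the mode has H^s norm R^{-γ/4}, which tends to 0 but more slowly than the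
  -- radius R^{-1/2}.
  set A : ℝ := bracket n' ^ (-s) * R ^ (-(γ / 4)) with hA
  have hA0 : 0 < A := mul_pos (bracket_rpow_pos _ _) (hRi _)
  set φ₁ : Sobolev s := φ₀ + mode s n' A with hφ₁
  have hnorm : ‖mode s n' (A : ℂ)‖ = R ^ (-(γ / 4)) := by
    rw [norm_mode, Complex.norm_real, Real.norm_of_nonneg hA0.le, hA, ← mul_assoc,
      ← Real.rpow_add (bracket_pos n')]
    simp
  refine ⟨φ₁, R ^ (-(1 / 2) : ℝ), hRi _, fun φ hφ => ?_, fun φ hφ => ?_⟩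
  · rw [Metric.mem_ball, dist_eq_norm] at hφ ⊢
    have e : φ - φ₀ = (φ - φ₁) + mode s n' A := by rw [hφ₁]; abel
    rw [e]
    refine (norm_add_le _ _).trans_lt ?_
    rw [hnorm]
    linarith
  rintro ⟨y, hy, hev⟩
  rw [Metric.mem_ball, dist_eq_norm] at hφ
  -- Long enough that Rt₁ = R^{γ/4} tends to infinity, short enough that Rt₁^{1+γ} and R^{1/2}t₁ are
  -- o(R^{-γ/4}).
  set t₁ := R ^ (γ / 4 - 1) with ht₁
  have hclose : ∀ k, ‖coef φ k - coef φ₀ k‖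
      ≤ K * R ^ (-(1 / 2) : ℝ) * bracket k ^ (-(s - 1 / 2)) := by
    intro k
    have e : coef φ k - coef φ₀ k = coef (φ - φ₁) k + coef (mode s n' A) k := by
      rw [← coef_sub, ← coef_add]; congr 1; rw [hφ₁]; abel
    have b1 : ‖coef (φ - φ₁) k‖ ≤ R ^ (-(1 / 2) : ℝ) * bracket k ^ (-(s - 1 / 2)) :=
      (norm_coef_le _ k).trans (mul_le_mul hφ.le (bracket_rpow_le_rpow k (by linarith))
        (bracket_rpow_pos _ _).le (hRi _).le)
    have b2 : ‖coef (mode s n' (A : ℂ)) k‖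
        ≤ β ^ (1 / 2 : ℝ) * R ^ (-(1 / 2) : ℝ) * bracket k ^ (-(s - 1 / 2)) := by
      rw [coef_mode]
      split_ifs with hk
      · subst hk
        rw [Complex.norm_real, Real.norm_of_nonneg hA0.le, hA]
        have c1 : R ^ (-(γ / 4)) ≤ 1 := by
          simpa using bracket_rpow_le_rpow n (by linarith : -(γ / 4) ≤ 0)
        have c2 : bracket n' ^ (-(1 / 2) : ℝ) ≤ β ^ (1 / 2 : ℝ) * R ^ (-(1 / 2) : ℝ) := by
          have d1 : R ^ (1 / 2 : ℝ) ≤ bracket n' ^ (1 / 2 : ℝ) * β ^ (1 / 2 : ℝ) := by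
            rw [← Real.mul_rpow (bracket_pos n').le hβ0.le]
            exact Real.rpow_le_rpow hR0.le hR' (by norm_num)
          have d2 := bracket_rpow_pos n' (1 / 2)
          have d3 := hRi (1 / 2)
          rw [Real.rpow_neg (bracket_pos n').le, Real.rpow_neg hR0.le, ← div_eq_mul_inv,
            inv_le_iff_one_le_mul₀ d2, div_mul_eq_mul_div, le_div_iff₀ d3]
          linarith
        have c3 : bracket n' ^ (-s) = bracket n' ^ (-(1 / 2) : ℝ) * bracket n' ^ (-(s - 1 / 2)) := by
          rw [← Real.rpow_add (bracket_pos n')]; congr 1; ring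
        calc bracket n' ^ (-s) * R ^ (-(γ / 4)) ≤ bracket n' ^ (-s) :=
              mul_le_of_le_one_right (bracket_rpow_pos _ _).le c1
          _ ≤ _ := by
              rw [c3]
              exact mul_le_mul_of_nonneg_right c2 (bracket_rpow_pos _ _).le
      · rw [norm_zero]
        exact mul_nonneg (mul_nonneg (by positivity) (hRi _).le) (bracket_rpow_pos _ _).le
    rw [e, hK, add_mul, add_mul, one_mul]
    exact (norm_add_le _ _).trans (add_le_add b1 b2)
  have hup := hbound hεabs hy hev n hn0 (by
    rw [hn]; push_cast
    have := mul_nonneg hsign (Nat.cast_nonneg (α := ℝ) N)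
    linarith) (K * R ^ (-(1 / 2) : ℝ)) (mul_nonneg (by positivity) (hRi _).le) hclose t₁
    ⟨(hRi _).le, h2.le⟩
  have hone : ((1 : ℕ) : ℝ) + 1 / 2 < s := by norm_num; linarith
  have hge := (SmoothPeriodic.expi (-n)).continuous
  have hgc := hg.smooth.continuous
  have hsplit : integralTorus (fun x => dfun 1 φ x * (g x * expi (-n) x))
      = integralTorus (fun x => dfun 1 (φ - φ₁) x * g x * expi (-n) x)
        + integralTorus (fun x => dfun 1 φ₀ x * g x * expi (-n) x) + I * n' * A * G := by
    have e3 : (fun x => dfun 1 φ x * (g x * expi (-n) x)) = fun x =>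
        (dfun 1 (φ - φ₁) x * g x * expi (-n) x + dfun 1 φ₀ x * g x * expi (-n) x)
          + I * n' * A * (g x * expi (-k₀) x) := by
      funext x
      have d1 := dfun_sub hone φ φ₁ x
      have d2 := dfun_sub hone φ₁ φ₀ x
      rw [show φ₁ - φ₀ = mode s n' A by rw [hφ₁]; abel, dfun_mode, pow_one] at d2
      have d3 : expi (-k₀) x = expi n' x * expi (-n) x := by
        rw [← expi_add]; congr 1; rw [hn']; ring
      rw [d1, d3]
      linear_combination -(g x * expi (-n) x) * d2
    have k1 : Continuous fun x => dfun 1 (φ - φ₁) x * g x * expi (-n) x :=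
      ((continuous_dfun hone _).mul hgc).mul hge
    have k2 : Continuous fun x => dfun 1 φ₀ x * g x * expi (-n) x :=
      ((continuous_dfun hone _).mul hgc).mul hge
    have k3 : Continuous fun x => g x * expi (-k₀) x := hgc.mul (continuous_expi _)
    have k4 : Continuous fun x => dfun 1 (φ - φ₁) x * g x * expi (-n) x
        + dfun 1 φ₀ x * g x * expi (-n) x := k1.add k2
    have k5 : Continuous fun x => I * n' * A * (g x * expi (-k₀) x) := continuous_const.mul k3
    rw [e3, integralTorus_add k4 k5, integralTorus_add k1 k2,
      integralTorus_const_mul]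
  have b1 : ‖integralTorus (fun x => dfun 1 (φ - φ₁) x * g x * expi (-n) x)‖
      ≤ Cm * Cg * R ^ (-(1 / 2) : ℝ) * R ^ (1 - s) := by
    have d := (hmul ((hasDecay_dfun_norm hone (φ - φ₁)).mono (by norm_num) hφ.le) hCg).norm_integral_le n
    rw [neg_sub] at d
    exact d.trans (le_of_eq (by ring))
  have b2 : ‖integralTorus (fun x => dfun 1 φ₀ x * g x * expi (-n) x)‖ ≤ C₀ * R⁻¹ * R ^ (1 - s) := by
    refine (hC₀.norm_integral_le n).trans (le_of_eq ?_)
    rw [mul_assoc, ← Real.rpow_neg_one, ← Real.rpow_add hR0]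
    congr 2; ring
  have b3 : c₁ * R ^ (-(γ / 4)) * R ^ (1 - s) ≤ ‖I * n' * A * G‖ := by
    rw [norm_mul, norm_mul, norm_mul, norm_I, one_mul, Complex.norm_intCast, Complex.norm_real,
      Real.norm_of_nonneg hA0.le]
    have d1 : bracket n' ≤ 2 * |(n' : ℝ)| := by
      have : (1 : ℝ) ≤ |(n' : ℝ)| := by exact_mod_cast Int.one_le_abs hn'0
      linarith [bracket_le_one_add_abs n']
    have d2 : (β * R) ^ (1 - s) ≤ bracket n' ^ (1 - s) :=
      Real.rpow_le_rpow_of_nonpos (bracket_pos n') hR'' (by linarith)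
    rw [Real.mul_rpow hβ0.le hR0.le] at d2
    have d3 : bracket n' ^ (1 - s) = bracket n' * bracket n' ^ (-s) := by
      rw [← Real.rpow_one_add' (bracket_pos n').le (by linarith)]; congr 1
    have d4 := bracket_rpow_pos n' (-s)
    have d5 := hRi (-(γ / 4))
    calc c₁ * R ^ (-(γ / 4)) * R ^ (1 - s)
        = 1 / 2 * (β ^ (1 - s) * R ^ (1 - s)) * (R ^ (-(γ / 4)) * ‖G‖) := by rw [hc₁]; ring
      _ ≤ 1 / 2 * (2 * |(n' : ℝ)| * bracket n' ^ (-s)) * (R ^ (-(γ / 4)) * ‖G‖) := by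
          refine mul_le_mul_of_nonneg_right (mul_le_mul_of_nonneg_left ?_ (by norm_num))
            (mul_nonneg d5.le (norm_nonneg _))
          exact (d3 ▸ d2).trans (mul_le_mul_of_nonneg_right d1 d4.le)
      _ = |(n' : ℝ)| * A * ‖G‖ := by rw [hA]; ring
  have hnR : |m.im| / 2 * R ≤ |(n : ℝ)| * |m.im| := by
    have : (1 : ℝ) ≤ |(n : ℝ)| := by exact_mod_cast Int.one_le_abs hn0
    have h5 : R ≤ 2 * |(n : ℝ)| := by linarith [bracket_le_one_add_abs n]
    nlinarith [abs_nonneg m.im]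
  have hexp : Real.exp (-(|(n : ℝ)| * |m.im|) * t₁) ≤ Real.exp (-(|m.im| / 2 * R) * t₁) := by
    refine Real.exp_le_exp.2 (mul_le_mul_of_nonneg_right (neg_le_neg hnR) (hRi _).le)
  have hlow : ‖I * n' * A * G‖ ≤ ‖integralTorus (fun x => dfun 1 φ x * (g x * expi (-n) x))‖
      + (‖integralTorus (fun x => dfun 1 (φ - φ₁) x * g x * expi (-n) x)‖
        + ‖integralTorus (fun x => dfun 1 φ₀ x * g x * expi (-n) x)‖) := by
    rw [hsplit]
    refine (norm_le_add_norm_add _ (integralTorus (fun x => dfun 1 (φ - φ₁) x * g x * expi (-n) x)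
        + integralTorus (fun x => dfun 1 φ₀ x * g x * expi (-n) x))).trans ?_
    rw [add_comm (I * n' * A * G)]
    gcongr
    exact norm_add_le _ _
  have hX := hRi (1 - s)
  set E := Real.exp (-(|m.im| / 2 * R) * t₁) + t₁
      + t₁ * (K * R ^ (-(1 / 2) : ℝ) + t₁ ^ γ) * R + R⁻¹ with hE
  have hup' : ‖integralTorus (fun x => dfun 1 φ x * (g x * expi (-n) x))‖ ≤ C * R ^ (1 - s) * E := by
    refine hup.trans (mul_le_mul_of_nonneg_left ?_ (mul_nonneg hC hX.le))
    rw [hE]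
    gcongr
  have hfinal : c₁ * R ^ (-(γ / 4)) * R ^ (1 - s)
      ≤ (Cm * Cg * R ^ (-(1 / 2) : ℝ) + C₀ * R⁻¹ + C * E) * R ^ (1 - s) := by
    refine (b3.trans (hlow.trans (add_le_add hup' (add_le_add b1 b2)))).trans (le_of_eq ?_)
    ring
  have hfinal2 := le_of_mul_le_mul_right hfinal hX
  have hρ := hRi (γ / 4)
  have hfinal3 := mul_le_mul_of_nonneg_left hfinal2 hρ.le
  -- Multiplication by R^{γ/4} leaves c₁ below a quantity that `h1` puts strictly under c₁.
  rw [mul_left_comm, ← Real.rpow_add hR0, add_neg_cancel, Real.rpow_zero, mul_one] at hfinal3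
  exact absurd h1 (not_lt.2 hfinal3)

end

/-! ### The Baire category argument -/

section

open Sobolev Filter Topology

variable {s : ℝ}

theorem support_coef_sum_mode_finite (u : Sobolev s) (S : Finset ℤ) :
    (Function.support (coef (∑ k ∈ S, mode s k (coef u k)))).Finite := by
  induction S using Finset.induction_on with
  | empty =>
    have : coef (0 : Sobolev s) = 0 := funext fun k => by
      have := coef_sub (0 : Sobolev s) 0 k
      rwa [sub_self, sub_self] at this
    simp [this]
  | insert k S hk ih =>
    rw [Finset.sum_insert hk]
    refine ((finite_singleton k).union ih).subset fun j hj => ?_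
    by_contra h
    simp only [mem_union, mem_singleton_iff, not_or, Function.mem_support, not_not] at h
    exact hj (by rw [coef_add, coef_mode, if_neg h.1, h.2, add_zero])

theorem exists_finite_support_mem {O : Set (Sobolev s)} (hO : IsOpen O) (hne : O.Nonempty) :
    ∃ φ₀ ∈ O, (Function.support (coef φ₀)).Finite := by
  obtain ⟨u, hu⟩ := hne
  obtain ⟨S, hS⟩ := ((hasSum_mode u).eventually (hO.mem_nhds hu)).exists
  exact ⟨_, hS, support_coef_sum_mode_finite u S⟩

theorem continuous_mean_nonlinFun (hs : 3 / 2 < s) (F : MvPolynomial (Fin 4) ℂ) :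
    Continuous fun ψ : Sobolev s => (integralTorus (nonlinFun F ψ)).im :=
  Complex.continuous_im.comp (continuous_integralTorus (continuous_nonlinFun_uncurry hs F))

/-- The nonvanishing condition on the mean is open. Near each point where it holds lies a
trigonometric polynomial, and near that a ball of data without solutions. Baire's theorem intersects
countably many such dense open sets. -/
theorem exists_forall_no_evolution (hs : 5 / 2 < s) (F : MvPolynomial (Fin 4) ℂ) {ψ : Sobolev s}
    (hψ : (integralTorus (nonlinFun (MvPolynomial.pderiv 1 F) ψ)).im ≠ 0) :
    ∃ φ : Sobolev s, ∀ ε : ℝ, ε = 1 ∨ ε = -1 → ∀ M τ : ℝ, 0 < τ →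
      ¬ ∃ y : ℝ → Sobolev s, (∀ t, ‖y t‖ ≤ M) ∧ IsEvolution F ε τ φ y := by
  have := Sobolev.completeSpace (s := s) (by linarith)
  set Ω : Set (Sobolev s) :=
    {ψ | (integralTorus (nonlinFun (MvPolynomial.pderiv 1 F) ψ)).im ≠ 0} with hΩ
  have hΩo : IsOpen Ω :=
    isOpen_ne_fun (continuous_mean_nonlinFun (by linarith) _) continuous_const
  -- A single index N encodes both the bound N and the time 1/(N+1), and the Boolean encodes the
  -- direction. Adjoining the complement of Ω makes these sets dense in the whole space.
  set U : ℕ × Bool → Set (Sobolev s) := fun i => interior ({φ | ¬ ∃ y : ℝ → Sobolev s,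
    (∀ t, ‖y t‖ ≤ i.1) ∧ IsEvolution F (if i.2 then 1 else -1) (1 / ((i.1 : ℝ) + 1)) φ y} ∪ Ωᶜ) with hU
  have hd : ∀ i, Dense (U i) := by
    intro i
    rw [dense_iff_inter_open]
    intro O hO hne
    by_cases hOΩ : (O ∩ Ω).Nonempty
    · obtain ⟨φ₀, hφ₀, hfin⟩ := exists_finite_support_mem (hO.inter hΩo) hOΩ
      obtain ⟨r₀, hr₀, hball⟩ := Metric.isOpen_iff.1 hO φ₀ hφ₀.1
      obtain ⟨φ₁, r, hr, hsub, hno⟩ := exists_ball_no_evolution hs F hfin hφ₀.2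
        (ε := if i.2 then 1 else -1) (by cases i.2 <;> simp) i.1
        (τ := 1 / ((i.1 : ℝ) + 1)) (by positivity) hr₀
      exact ⟨φ₁, hball (hsub (Metric.mem_ball_self hr)), mem_interior.2
        ⟨_, fun φ hφ => Or.inl (hno φ hφ), Metric.isOpen_ball, Metric.mem_ball_self hr⟩⟩
    · obtain ⟨φ, hφ⟩ := hne
      exact ⟨φ, hφ, mem_interior.2 ⟨O, fun φ' hφ' => Or.inr fun h => hOΩ ⟨φ', hφ', h⟩, hO, hφ⟩⟩
  obtain ⟨φ, hφΩ, hφU⟩ := (dense_iInter_of_isOpen (fun i => isOpen_interior) hd).inter_open_nonempty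
    Ω hΩo ⟨ψ, hψ⟩
  refine ⟨φ, fun ε hε M τ hτ => ?_⟩
  rintro ⟨y, hy, hev⟩
  -- N dominates both M and 1/τ, so the evolution restricts to [0, 1/(N+1)] with bound N.
  obtain ⟨N, hN⟩ := exists_nat_ge (max M (1 / τ))
  have hτN : 1 / ((N : ℝ) + 1) ≤ τ := by
    rw [div_le_comm₀ (by positivity) hτ]
    linarith [(le_max_right M (1 / τ)).trans hN]
  have key : ∀ b : Bool, ε = (if b then 1 else -1) → False := fun b hb =>
    (interior_subset (mem_iInter.1 hφU (N, b))).elim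
      (fun h => h ⟨y, fun t => (hy t).trans ((le_max_left M (1 / τ)).trans hN),
        hb ▸ hev.mono hτN⟩) (fun h => h hφΩ)
  rcases hε with h | h
  · exact key true (by simpa using h)
  · exact key false (by simpa using h)

end

end PeriodicNLS

end

theorem mainTheorem2 (F : MvPolynomial (Fin 4) ℂ) (s : ℝ) (hs : 5 / 2 < s)
    (hF : ∃ ψ : PeriodicNLS.Sobolev s,
      PeriodicNLS.integralTorus (fun x => (PeriodicNLS.nonlinBeta F ψ x).im) ≠ 0) :
    ∃ φ : PeriodicNLS.Sobolev s, ∀ T : ℝ, 0 < T →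
      (¬ ∃ u : ℝ → PeriodicNLS.Sobolev s,
        ContinuousOn u (Set.Icc 0 T) ∧ PeriodicNLS.IsSolutionForward F s T φ u) ∧
      (¬ ∃ u : ℝ → PeriodicNLS.Sobolev s,
        ContinuousOn u (Set.Icc (-T) 0) ∧ PeriodicNLS.IsSolutionBackward F s T φ u) := by
  obtain ⟨ψ, hψ⟩ := hF
  have hs' : 3 / 2 < s := by linarith
  rw [PeriodicNLS.Sobolev.integralTorus_nonlinBeta_im hs'] at hψ
  obtain ⟨φ, hφ⟩ := PeriodicNLS.exists_forall_no_evolution hs F hψ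
  refine ⟨φ, fun T hT => ⟨?_, ?_⟩⟩
  · rintro ⟨u, hu, h⟩
    -- Continuity on the compact time interval supplies the bound M that `hφ` excludes.
    obtain ⟨y, -, ⟨M, hM⟩, hy⟩ := PeriodicNLS.exists_isEvolution_of_forward hs' hT hu h
    exact hφ 1 (Or.inl rfl) M T hT ⟨y, hM, hy⟩
  · rintro ⟨u, hu, h⟩
    obtain ⟨y, -, ⟨M, hM⟩, hy⟩ := PeriodicNLS.exists_isEvolution_of_backward hs' hT hu h
    exact hφ (-1) (Or.inr rfl) M T hT ⟨y, hM, hy⟩
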